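/- Let $S$ be a left cancellative monoid with identity $e$. Let $I_\ell(S)$ be the inverse semigroup of partial bijections of $S$ generated by the left translations, and $\mathcal J(S)$ the collection of constructible right ideals $X=s_1^{-1}t_1\cdots s_n^{-1}t_nS$; the idempotents of $I_\ell(S)$ are exactly the identity maps $p_X$ of the sets $X\in\mathcal J(S)$. Let $\mathcal G(I_\ell(S))$ be the Paterson groupoid of germs $[g,\chi]$, where $g\in I_\ell(S)$ and $\chi$ is a semi-character (a multiplicative, not identically zero, $\{0,1\}$-valued map) on the semilattice $E(S)$ of idempotents of $I_\ell(S)$ with $\chi(g^{-1}g)=1$, and where $[g,\chi]=[h,\chi]$ iff $gp=hp$ for some $p\in E(S)$ with $\chi(p)=1$; its topology has as a basis the sets $\{[g,\chi]:\chi\in U\}$ with $U$ open in $\{\chi:\chi(g^{-1}g)=1\}$. For $s\in S$ let $\chi_s(p_X)=\mathbf 1_X(s)$, let $\Omega(S)$ be the closure of $\{\chi_s : s\in S\}$ in the topology of pointwise convergence (the closure of the orbit of $\chi_e$), and let $\mathcal G_P(S)$ be the reduction of $\mathcal G(I_\ell(S))$ to $\Omega(S)$. Let $\mathcal G(S)=\mathcal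 G_P(S)/{\sim}$ be the quotient groupoid, where $[g,\chi]\sim[h,\chi]$ iff there are $X,X_1,\dots,X_m\in\mathcal J(S)$, $m\ge 0$, with $\chi(p_X)=1$, $\chi(p_{X_i})=0$ for all $i$, and $g=h$ on $X\setminus\bigcup_i X_i$. Let $C^*_r(\mathcal G_P(S))$ be the reduced groupoid C$^*$-algebra, that is, the completion of $C_c(\mathcal G_P(S))$ in the norm $\|f\|_r=\sup_x\|\rho_x(f)\|$, where $(\rho_x(f)\xi)(g)=\sum_{r(h)=r(g)}f(h)\xi(h^{-1}g)$ on $\ell^2(s^{-1}(x))$. Let $C^*_r(S)\subset B(\ell^2(S))$ be the C$^*$-algebra generated by the operators $\lambda_s\delta_t=\delta_{st}$, $s\in S$. View $\rho_{\chi_e}$ as a representation on $\ell^2(S)$ through the bijection $S\to s^{-1}(\chi_e)$, $s\mapsto[s,\chi_e]$. 1. If $\rho_{\chi_e}$ defines an isomorphism $C^*_r(\mathcal G_P(S))\cong C^*_r(S)$, then $\mathcal G_P(S)=\mathcal G(S)$; that is, the quotient map $\mathcal G_P(S)\to\mathcal G(S)$ is an isomorphism of topological groupoids. 2. In particular, $\mathcal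 G_P(S)=\mathcal G(S)$ in the same sense whenever $S$ is strongly C$^*$-regular, that is, whenever the following holds: for all $h_1,\dots,h_n\in I_\ell(S)$ and $X,X_1,\dots,X_m\in\mathcal J(S)$ ($m\ge0$) with $\emptyset\ne X\setminus\bigcup_iX_i\subset\bigcup_k\{s\in S:h_ks=s\}$ there are $Y_1,\dots,Y_l\in\mathcal J(S)$ and indices $k_1,\dots,k_l\in\{1,\dots,n\}$ with $X\setminus\bigcup_iX_i\subset\bigcup_jY_j$ and $h_{k_j}p_{Y_j}=p_{Y_j}$ for all $j$. -/

import Mathlib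

open scoped ENNReal

universe u v

/-! ### Groupoids, their convolution functions and their reduced C*-algebras -/

/-- A groupoid with set of arrows `G` and set of objects `X`. The product `mul a b h` is defined
when the source of `a` is the range of `b`, and `unit` embeds the objects into the arrows. -/
class Grpd (X : outParam (Type u)) (G : Type v) where
  src : G → X
  rng : G → X
  unit : X → G
  inv : G → G
  mul : (a b : G) → src a = rng b → G
  src_unit : ∀ x, src (unit x) = x
  rng_unit : ∀ x, rng (unit x) = x
  src_inv : ∀ a, src (inv a) = rng a
  rng_inv : ∀ a, rng (inv a) = src a
  src_mul : ∀ a b h, src (mul a b h) = src b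
  rng_mul : ∀ a b h, rng (mul a b h) = rng a
  mul_assoc : ∀ a b c (h : src a = rng b) (h' : src b = rng c),
    mul (mul a b h) c ((src_mul a b h).trans h') =
      mul a (mul b c h') (h.trans (rng_mul b c h').symm)
  mul_unit : ∀ a, mul a (unit (src a)) (rng_unit _).symm = a
  unit_mul : ∀ a, mul (unit (rng a)) a (src_unit _) = a
  inv_mul : ∀ a, mul (inv a) a (src_inv a) = unit (src a)
  mul_inv : ∀ a, mul a (inv a) (rng_inv a).symm = unit (rng a)

namespace Grpd

/-- The reduction of a groupoid to an invariant set `Ω` of objects. -/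
@[reducible]
def reduction {X : Type u} {G : Type v} [Grpd X G] (Ω : Set X)
    (hΩ : ∀ a : G, src a ∈ Ω → rng a ∈ Ω) : Grpd Ω {a : G // src a ∈ Ω} where
  src a := ⟨src a.1, a.2⟩
  rng a := ⟨rng a.1, hΩ _ a.2⟩
  unit x := ⟨unit x.1, by rw [src_unit]; exact x.2⟩
  inv a := ⟨inv a.1, by rw [src_inv]; exact hΩ _ a.2⟩
  mul a b h := ⟨mul a.1 b.1 (congrArg Subtype.val h), by rw [src_mul]; exact b.2⟩
  src_unit x := Subtype.ext (src_unit _)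
  rng_unit x := Subtype.ext (rng_unit _)
  src_inv a := Subtype.ext (src_inv _)
  rng_inv a := Subtype.ext (rng_inv _)
  src_mul a b h := Subtype.ext (src_mul _ _ _)
  rng_mul a b h := Subtype.ext (rng_mul _ _ _)
  mul_assoc a b c h h' := Subtype.ext (mul_assoc _ _ _ _ _)
  mul_unit a := Subtype.ext (mul_unit _)
  unit_mul a := Subtype.ext (unit_mul _)
  inv_mul a := Subtype.ext (inv_mul _)
  mul_inv a := Subtype.ext (mul_inv _)

/-- A map between topological groupoids with the same objects is an isomorphism of topological
groupoids (over the identity on objects). -/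
structure IsTopIso {X : Type u} {G H : Type v} [Grpd X G] [Grpd X H] [TopologicalSpace G]
    [TopologicalSpace H] (φ : G → H) : Prop where
  isHomeomorph : IsHomeomorph φ
  src_map : ∀ a, src (φ a) = src a
  rng_map : ∀ a, rng (φ a) = rng a
  unit_map : ∀ x, φ (unit x) = unit x
  inv_map : ∀ a, φ (inv a) = inv (φ a)
  mul_map : ∀ a b (h : src a = rng b),
    φ (mul a b h) = mul (φ a) (φ b) (by rw [src_map, rng_map, h])

end Grpd

/-- The Hilbert space `ℓ²(ι)`. -/
abbrev EllTwo (ι : Type u) : Type u := lp (fun _ : ι => ℂ) 2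

/-- The space `C_c(G)` of a possibly non-Hausdorff space: the linear span of the continuous
compactly supported functions on the open Hausdorff subsets `V`, extended by zero to `G`. -/
def CcSpan (G : Type v) [TopologicalSpace G] : Submodule ℂ (G → ℂ) :=
  Submodule.span ℂ {f | ∃ V : Set G, IsOpen V ∧ T2Space V ∧ ContinuousOn f V ∧
    ∃ K : Set G, K ⊆ V ∧ IsCompact K ∧ ∀ g, g ∉ K → f g = 0}

section reduced

variable {X : Type u} (G : Type v) [Grpd X G]

/-- `G_x = s⁻¹(x)`. -/
abbrev SrcFiber (x : X) : Type v := {g : G // Grpd.src g = x}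

variable {G}

/-- `h⁻¹g ∈ G_x` for `g ∈ G_x` and `h` with `r(h) = r(g)`. -/
def SrcFiber.invMul {x : X} (g : SrcFiber G x) (h : G) (hh : Grpd.rng h = Grpd.rng g.1) :
    SrcFiber G x :=
  ⟨Grpd.mul (Grpd.inv h) g.1 ((Grpd.src_inv h).trans hh), (Grpd.src_mul _ _ _).trans g.2⟩

/-- The bounded operator `T` on `ℓ²(G_x)` is `ρ_x(f)`, that is,
`(T ξ)(g) = ∑_{h ∈ G^{r(g)}} f(h) ξ(h⁻¹g)`. -/
def IsRho (x : X) (f : G → ℂ) (T : EllTwo (SrcFiber G x) →L[ℂ] EllTwo (SrcFiber G x)) : Prop :=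
  ∀ (ξ : EllTwo (SrcFiber G x)) (g : SrcFiber G x),
    T ξ g = ∑' h : {h : G // Grpd.rng h = Grpd.rng g.1}, f h.1 * ξ (g.invMul h.1 h.2)

variable (G)

/-- The C*-algebra of bounded families `(T_x)_x` of bounded operators on the spaces `ℓ²(G_x)`, with
the pointwise operations and the norm `sup_x ‖T_x‖`. -/
def FiberOps : Type (max u v) :=
  lp (fun x : X => EllTwo (SrcFiber G x) →L[ℂ] EllTwo (SrcFiber G x)) ∞

noncomputable instance : NonUnitalCStarAlgebra (FiberOps G) :=
  inferInstanceAs (NonUnitalCStarAlgebra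
    (lp (fun x : X => EllTwo (SrcFiber G x) →L[ℂ] EllTwo (SrcFiber G x)) ∞))

/-- The reduced C*-algebra of an étale groupoid. The reduced norm of `f ∈ C_c(G)` is
`sup_x ‖ρ_x(f)‖`, so the completion is the closure of the image of `C_c(G)` under the
`*`-homomorphism `f ↦ (ρ_x(f))_x`. (For an étale groupoid every `f ∈ C_c(G)` acts by a bounded
family of bounded operators, and the image of `C_c(G)` is a `*`-subalgebra, so that passing to the
generated `*`-subalgebra adds nothing.) -/
noncomputable def reducedCStar [TopologicalSpace G] : NonUnitalStarSubalgebra ℂ (FiberOps G) :=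
  (NonUnitalStarAlgebra.adjoin ℂ
    {a : FiberOps G | ∃ f ∈ CcSpan G, ∀ x : X, IsRho x f (a.1 x)}).topologicalClosure

/-- The representation `ρ_x` of the reduced C*-algebra on `ℓ²(G_x)`. -/
noncomputable def rho [TopologicalSpace G] (x : X) :
    reducedCStar G →⋆ₙₐ[ℂ] (EllTwo (SrcFiber G x) →L[ℂ] EllTwo (SrcFiber G x)) where
  toFun a := a.1.1 x
  map_smul' _ _ := rfl
  map_zero' := rfl
  map_add' _ _ := rfl
  map_mul' _ _ := rfl
  map_star' _ := rfl

end reduced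

/-! ### The left inverse hull and the constructible ideals -/

section hull

variable (S : Type u) [LeftCancelMonoid S]

open Classical in
/-- The left translation `t ↦ s * t`, as a partial bijection of `S` with domain `S`. -/
noncomputable def leftTranslation {S : Type u} [LeftCancelMonoid S] (s : S) : S ≃. S where
  toFun t := some (s * t)
  invFun t := if h : ∃ x, s * x = t then some h.choose else none
  inv a b := by
    constructor
    · intro h
      split_ifs at h with hx
      have := hx.choose_spec
      simp only [Option.some.injEq] at h
      rw [h] at this
      rw [this]
    · intro h
      simp only [Option.some.injEq] at h
      have hx : ∃ x, s * x = b := ⟨a, h⟩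
      rw [dif_pos hx]
      exact congrArg some (mul_left_cancel (hx.choose_spec.trans h.symm))

/-- The partial bijections in the inverse semigroup generated by the left translations
(`f.trans g` is "first `f`, then `g`"). -/
inductive MemInvHull {S : Type u} [LeftCancelMonoid S] : (S ≃. S) → Prop
  | left (s : S) : MemInvHull (leftTranslation s)
  | symm (g : S ≃. S) : MemInvHull g → MemInvHull g.symm
  | trans (g h : S ≃. S) : MemInvHull g → MemInvHull h → MemInvHull (g.trans h)

/-- The left inverse hull `I_ℓ(S)`. -/
def InvHull : Type u := {g : S ≃. S // MemInvHull g}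

/-- The constructible right ideals `s₁⁻¹ t₁ ⋯ sₙ⁻¹ tₙ S`, where `s⁻¹` denotes the preimage
under left translation by `s`. -/
inductive IsConstructible : Set S → Prop
  | univ : IsConstructible Set.univ
  | step (s t : S) (X : Set S) :
      IsConstructible X → IsConstructible ((fun x => s * x) ⁻¹' ((fun x => t * x) '' X))

/-- The collection `𝒥(S)` of constructible right ideals. -/
def ConstrIdeal : Type u := {X : Set S // IsConstructible S X}

variable {S}

namespace InvHull

/-- The inverse in `I_ℓ(S)`. -/
def inv (g : InvHull S) : InvHull S := ⟨g.1.symm, .symm _ g.2⟩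

/-- The product `gh` in `I_ℓ(S)`: first `h`, then `g`. -/
def mul (g h : InvHull S) : InvHull S := ⟨h.1.trans g.1, .trans _ _ h.2 g.2⟩

/-- The element of `I_ℓ(S)` given by `s ∈ S`. -/
noncomputable def ofElem (s : S) : InvHull S := ⟨leftTranslation s, .left s⟩

/-- The domain of definition of `g`. -/
def domSet (g : InvHull S) : Set S := {s | (g.1 s).isSome}

/-- The preimage `g⁻¹(A) = {s ∈ dom g | gs ∈ A}`. -/
def preSet (g : InvHull S) (A : Set S) : Set S := {s | ∃ t ∈ A, g.1 s = some t}

end InvHull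

theorem leftTranslation_apply (s t : S) : leftTranslation s t = some (s * t) := rfl

theorem leftTranslation_one : leftTranslation (1 : S) = PEquiv.refl S := by
  ext x y; simp [leftTranslation_apply]

theorem leftTranslation_symm_eq (s a b : S) :
    (leftTranslation s).symm a = some b ↔ s * b = a := by
  rw [PEquiv.eq_some_iff, leftTranslation_apply, Option.some.injEq]

theorem IsConstructible.pre_both {g : S ≃. S} (hg : MemInvHull g) :
    ∀ X, IsConstructible S X → IsConstructible S {s | ∃ t ∈ X, g s = some t} ∧
      IsConstructible S {s | ∃ t ∈ X, g.symm s = some t} := by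
  induction hg with
  | left s =>
    intro X hX
    constructor
    · have := IsConstructible.step s 1 X hX
      convert this using 1
      ext x
      simp [leftTranslation_apply]
    · have := IsConstructible.step 1 s X hX
      convert this using 1
      ext x
      simp [leftTranslation_symm_eq]
  | symm g _ ih => exact fun X hX => ⟨(ih X hX).2, (ih X hX).1⟩
  | trans g h _ _ ihg ihh =>
    intro X hX
    constructor
    · convert (ihg _ (ihh X hX).1).1 using 1
      ext x
      simp only [Set.mem_ofPred_eq, PEquiv.trans_eq_some]
      constructor
      · rintro ⟨t, ht, b, hb, hb'⟩; exact ⟨b, ⟨t, ht, hb'⟩, hb⟩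
      · rintro ⟨b, ⟨t, ht, hb'⟩, hb⟩; exact ⟨t, ht, b, hb, hb'⟩
    · convert (ihh _ (ihg X hX).2).2 using 1
      ext x
      simp only [Set.mem_ofPred_eq, PEquiv.symm_trans_rev, PEquiv.trans_eq_some]
      constructor
      · rintro ⟨t, ht, b, hb, hb'⟩; exact ⟨b, ⟨t, ht, hb'⟩, hb⟩
      · rintro ⟨b, ⟨t, ht, hb'⟩, hb⟩; exact ⟨t, ht, b, hb, hb'⟩

theorem InvHull.isConstructible_preSet (g : InvHull S) {X : Set S} (hX : IsConstructible S X) :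
    IsConstructible S (g.preSet X) := (IsConstructible.pre_both g.2 X hX).1

theorem InvHull.preSet_univ (g : InvHull S) : g.preSet Set.univ = g.domSet := by
  ext s; simp [preSet, domSet, Option.isSome_iff_exists]

theorem InvHull.isConstructible_domSet (g : InvHull S) : IsConstructible S g.domSet := by
  rw [← g.preSet_univ]; exact g.isConstructible_preSet .univ

theorem IsConstructible.exists_domSet {X : Set S} (hX : IsConstructible S X) :
    ∃ g : InvHull S, g.domSet = X := by
  induction hX with
  | univ => exact ⟨InvHull.ofElem 1, by ext; simp [InvHull.domSet, InvHull.ofElem,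
      leftTranslation_apply]⟩
  | step s t X _ ih =>
    obtain ⟨g, rfl⟩ := ih
    refine ⟨g.mul ((InvHull.ofElem t).inv.mul (InvHull.ofElem s)), ?_⟩
    ext x
    simp only [InvHull.domSet, InvHull.mul, InvHull.inv, InvHull.ofElem, Set.mem_ofPred_eq,
      Option.isSome_iff_exists, PEquiv.trans_eq_some, leftTranslation_apply, Option.some.injEq,
      leftTranslation_symm_eq, Set.mem_preimage, Set.mem_image]
    constructor
    · rintro ⟨a, b, ⟨c, rfl, h⟩, hb⟩; exact ⟨b, ⟨a, hb⟩, h⟩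
    · rintro ⟨b, ⟨a, hb⟩, h⟩; exact ⟨a, b, ⟨_, rfl, h⟩, hb⟩

open Classical in
/-- `E(S) ≅ 𝒥(S)`: the idempotents of `I_ℓ(S)` are exactly the identity maps `p_X` of the
constructible ideals `X`. -/
theorem InvHull.idempotent_iff (p : S ≃. S) :
    (MemInvHull p ∧ p.trans p = p) ↔ ∃ X, IsConstructible S X ∧ p = PEquiv.ofSet X := by
  constructor
  · rintro ⟨hp, hpp⟩
    refine ⟨_, InvHull.isConstructible_domSet ⟨p, hp⟩, ?_⟩
    ext x y
    have key : ∀ z, p x = some z → x = z := by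
      intro z hz
      have h2 : (p.trans p) x = some z := by rw [hpp, hz]
      rw [PEquiv.trans_eq_some] at h2
      obtain ⟨b, hb, hb'⟩ := h2
      rw [hz, Option.some.injEq] at hb
      subst hb
      exact p.inj hz hb'
    simp only [PEquiv.ofSet_eq_some_iff, InvHull.domSet, Set.mem_ofPred_eq,
      Option.isSome_iff_exists]
    constructor
    · intro h
      have := key y h
      subst this
      exact ⟨rfl, _, h⟩
    · rintro ⟨rfl, z, hz⟩
      have := key z hz
      subst this
      exact hz
  · rintro ⟨X, hX, rfl⟩
    obtain ⟨g, rfl⟩ := hX.exists_domSet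
    constructor
    · have := MemInvHull.trans _ _ g.2 (.symm _ g.2)
      rw [PEquiv.self_trans_symm] at this
      have hd : g.domSet = {a | (g.1 a).isSome} := rfl
      rw! [hd]
      convert this
    · ext x y
      rw [PEquiv.trans_eq_some]
      simp only [PEquiv.ofSet_eq_some_iff]
      constructor
      · rintro ⟨b, ⟨rfl, h⟩, ⟨rfl, _⟩⟩; exact ⟨rfl, h⟩
      · rintro ⟨rfl, h⟩; exact ⟨_, ⟨rfl, h⟩, ⟨rfl, h⟩⟩

theorem IsConstructible.inter {X Y : Set S} (hX : IsConstructible S X)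
    (hY : IsConstructible S Y) : IsConstructible S (X ∩ Y) := by
  classical
  have h := ((InvHull.idempotent_iff (PEquiv.ofSet X)).2 ⟨X, hX, rfl⟩).1
  convert (IsConstructible.pre_both h Y hY).1 using 1
  ext s
  simp only [PEquiv.ofSet_eq_some_iff, Set.mem_inter_iff, Set.mem_ofPred_eq]
  constructor
  · rintro ⟨h1, h2⟩; exact ⟨s, h2, rfl, h1⟩
  · rintro ⟨t, h1, rfl, h2⟩; exact ⟨h2, h1⟩

namespace ConstrIdeal

/-- The semigroup operation of `𝒥(S)`. -/
def inter (X Y : ConstrIdeal S) : ConstrIdeal S := ⟨X.1 ∩ Y.1, X.2.inter Y.2⟩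

/-- The ideal `S`. -/
def univ : ConstrIdeal S := ⟨Set.univ, .univ⟩

end ConstrIdeal

/-- The domain of `g`, a constructible ideal; `p_{dom g} = g⁻¹g`. -/
def InvHull.dom (g : InvHull S) : ConstrIdeal S := ⟨g.domSet, g.isConstructible_domSet⟩

/-- The constructible ideal `g⁻¹(X)`; `p_{g⁻¹(X)} = g⁻¹ p_X g`. -/
def InvHull.pre (g : InvHull S) (X : ConstrIdeal S) : ConstrIdeal S :=
  ⟨g.preSet X.1, g.isConstructible_preSet X.2⟩

variable (S) in
/-- Semi-characters of `E(S) ≅ 𝒥(S)`: multiplicative maps to `{0,1}` that are not identically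
zero. We write `χ X` for `χ(p_X)`. The topology is that of pointwise convergence. -/
abbrev SemiChar : Type u :=
  {χ : ConstrIdeal S → Bool // (∀ X Y, χ (X.inter Y) = (χ X && χ Y)) ∧ ∃ X, χ X = true}

namespace SemiChar

theorem inter_eq_true (χ : SemiChar S) (X Y : ConstrIdeal S) :
    χ.1 (X.inter Y) = true ↔ χ.1 X = true ∧ χ.1 Y = true := by
  rw [χ.2.1, Bool.and_eq_true]

theorem mono (χ : SemiChar S) {X Y : ConstrIdeal S} (h : X.1 ⊆ Y.1) (hX : χ.1 X = true) :
    χ.1 Y = true := by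
  have : X.inter Y = X := Subtype.ext (Set.inter_eq_left.2 h)
  rw [← this, inter_eq_true] at hX
  exact hX.2

theorem univ_eq (χ : SemiChar S) : χ.1 ConstrIdeal.univ = true :=
  let ⟨_, hX⟩ := χ.2.2
  χ.mono (Set.subset_univ _) hX

theorem dom_mul (g h : InvHull S) : (g.mul h).dom = h.pre g.dom := by
  apply Subtype.ext
  ext s
  simp only [InvHull.dom, InvHull.pre, InvHull.mul, InvHull.domSet, InvHull.preSet,
    Set.mem_ofPred_eq, Option.isSome_iff_exists, PEquiv.trans_eq_some]
  constructor
  · rintro ⟨a, b, h1, h2⟩; exact ⟨b, ⟨a, h2⟩, h1⟩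
  · rintro ⟨b, ⟨a, h2⟩, h1⟩; exact ⟨a, b, h1, h2⟩

/-- The semi-character `χ(g⁻¹ · g)`, for `χ(g⁻¹g) = 1`. -/
def act (g : InvHull S) (χ : SemiChar S) (h : χ.1 g.dom = true) : SemiChar S :=
  ⟨fun X => χ.1 (g.pre X), fun X Y => by
    rw [← χ.2.1]
    refine congrArg χ.1 ?_
    apply Subtype.ext
    ext s
    simp only [InvHull.pre, InvHull.preSet, ConstrIdeal.inter, Set.mem_inter_iff, Set.mem_ofPred_eq]
    constructor
    · rintro ⟨t, ⟨h1, h2⟩, h3⟩; exact ⟨⟨t, h1, h3⟩, ⟨t, h2, h3⟩⟩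
    · rintro ⟨⟨t, h1, h3⟩, ⟨t', h2, h4⟩⟩
      rw [h3, Option.some.injEq] at h4
      subst h4
      exact ⟨t, ⟨h1, h2⟩, h3⟩,
    ConstrIdeal.univ, by
      have : g.pre ConstrIdeal.univ = g.dom := Subtype.ext g.preSet_univ
      exact (congrArg χ.1 this).trans h⟩

open Classical in
/-- The semi-character `χ_s(p_X) = 1_X(s)`. -/
noncomputable def point (s : S) : SemiChar S :=
  ⟨fun X => decide (s ∈ X.1), fun X Y => by simp [ConstrIdeal.inter], ConstrIdeal.univ,
    by simp [ConstrIdeal.univ]⟩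

theorem point_eq_true (s : S) (X : ConstrIdeal S) : (point s).1 X = true ↔ s ∈ X.1 := by
  simp [point]

end SemiChar

end hull

/-! ### The groupoid of the left inverse hull and its reduction -/

section paterson

variable {S : Type u} [LeftCancelMonoid S]

namespace InvHull

theorem preSet_mul (g h : InvHull S) (A : Set S) : (g.mul h).preSet A = h.preSet (g.preSet A) := by
  ext s
  simp only [mul, preSet, Set.mem_ofPred_eq, PEquiv.trans_eq_some]
  constructor
  · rintro ⟨a, ha, b, h1, h2⟩; exact ⟨b, ⟨a, ha, h2⟩, h1⟩
  · rintro ⟨b, ⟨a, ha, h2⟩, h1⟩; exact ⟨a, ha, b, h1, h2⟩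

theorem pre_mul (g h : InvHull S) (X : ConstrIdeal S) : (g.mul h).pre X = h.pre (g.pre X) :=
  Subtype.ext (preSet_mul g h X.1)

theorem preSet_inv_preSet (g : InvHull S) (A : Set S) :
    g.preSet (g.inv.preSet A) = g.domSet ∩ A := by
  ext s
  simp only [inv, preSet, domSet, Set.mem_inter_iff, Set.mem_ofPred_eq, PEquiv.eq_some_iff,
    Option.isSome_iff_exists]
  constructor
  · rintro ⟨t, ⟨r, hr, h1⟩, h2⟩
    have := g.1.inj h1 h2
    subst this
    exact ⟨⟨t, h2⟩, hr⟩
  · rintro ⟨⟨t, h2⟩, hs⟩; exact ⟨t, ⟨s, hs, h2⟩, h2⟩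

/-- The identity element of `I_ℓ(S)`. -/
noncomputable def one : InvHull S := ofElem 1

theorem one_val : (one : InvHull S).1 = PEquiv.refl S := leftTranslation_one

theorem preSet_one (A : Set S) : (one : InvHull S).preSet A = A := by
  ext s; simp [preSet, one_val]

theorem ofElem_dom (s : S) : (ofElem s).dom = ConstrIdeal.univ := by
  apply Subtype.ext
  ext t
  simp [dom, ConstrIdeal.univ, domSet, ofElem, leftTranslation_apply]

end InvHull

namespace SemiChar

theorem pre_inv_eq (χ : SemiChar S) (g : InvHull S) (h : χ.1 g.dom = true) (X : ConstrIdeal S) :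
    χ.1 (g.pre (g.inv.pre X)) = χ.1 X := by
  have : g.pre (g.inv.pre X) = g.dom.inter X := Subtype.ext (g.preSet_inv_preSet X.1)
  rw [this, χ.2.1, h, Bool.true_and]

theorem act_inv_dom (χ : SemiChar S) (g : InvHull S) (h : χ.1 g.dom = true) :
    (act g χ h).1 g.inv.dom = true := by
  have h1 := χ.pre_inv_eq g h ConstrIdeal.univ
  have h2 : g.inv.pre ConstrIdeal.univ = g.inv.dom := Subtype.ext g.inv.preSet_univ
  rw [h2, χ.univ_eq] at h1
  exact h1

theorem act_inv_act (χ : SemiChar S) (g : InvHull S) (h : χ.1 g.dom = true) :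
    act g.inv (act g χ h) (χ.act_inv_dom g h) = χ :=
  Subtype.ext (funext fun X => χ.pre_inv_eq g h X)

theorem act_one (χ : SemiChar S) (h : χ.1 InvHull.one.dom = true) :
    act InvHull.one χ h = χ :=
  Subtype.ext (funext fun X => congrArg χ.1 (Subtype.ext (InvHull.preSet_one X.1)))

theorem mul_dom (χ : SemiChar S) (g h : InvHull S) (hh : χ.1 h.dom = true)
    (hg : (act h χ hh).1 g.dom = true) : χ.1 (g.mul h).dom = true := by
  rw [dom_mul]; exact hg

theorem act_mul (χ : SemiChar S) (g h : InvHull S) (hh : χ.1 h.dom = true)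
    (hg : (act h χ hh).1 g.dom = true) :
    act (g.mul h) χ (χ.mul_dom g h hh hg) = act g (act h χ hh) hg :=
  Subtype.ext (funext fun X => congrArg χ.1 (InvHull.pre_mul g h X))

/-- `A` is a constructible ideal with `χ(p_A) = 1`. -/
def Holds (χ : SemiChar S) (A : Set S) : Prop := ∃ X : ConstrIdeal S, A = X.1 ∧ χ.1 X = true

/-- `A` has the form `X \ (X₁ ∪ ⋯ ∪ X_m)` for constructible ideals `X, X₁, …, X_m` (`m ≥ 0`) such
that `χ(p_X) = 1` and `χ(p_{X_i}) = 0` for all `i`; that is, the extension of `χ` to the sets of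
this form takes the value `1` at `A`. -/
def HoldsExt (χ : SemiChar S) (A : Set S) : Prop :=
  ∃ (X : ConstrIdeal S) (F : Finset (ConstrIdeal S)), A = X.1 \ ⋃ Y ∈ F, Y.1 ∧
    χ.1 X = true ∧ ∀ Y ∈ F, χ.1 Y = false

/-- Auxiliary: properties shared by `Holds` and `HoldsExt`. -/
structure GermSys (N : SemiChar S → Set S → Prop) : Prop where
  ideal : ∀ χ (X : ConstrIdeal S), χ.1 X = true → N χ X.1
  inter : ∀ χ A B, N χ A → N χ B → N χ (A ∩ B)
  pre : ∀ χ (g : InvHull S) (h : χ.1 g.dom = true) A, N (act g χ h) A → N χ (g.preSet A)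

theorem germSys_holds : GermSys (Holds (S := S)) where
  ideal _ X h := ⟨X, rfl, h⟩
  inter := by
    rintro χ _ _ ⟨X, rfl, hX⟩ ⟨Y, rfl, hY⟩
    exact ⟨X.inter Y, rfl, (χ.inter_eq_true X Y).2 ⟨hX, hY⟩⟩
  pre := by
    rintro χ g h _ ⟨X, rfl, hX⟩
    exact ⟨g.pre X, rfl, hX⟩

theorem germSys_holdsExt : GermSys (HoldsExt (S := S)) where
  ideal _ X h := ⟨X, ∅, by simp, h, by simp⟩
  inter := by
    classical
    rintro χ _ _ ⟨X, F, rfl, hX, hF⟩ ⟨Y, F', rfl, hY, hF'⟩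
    refine ⟨X.inter Y, F ∪ F', ?_, (χ.inter_eq_true X Y).2 ⟨hX, hY⟩, ?_⟩
    · ext s
      simp only [ConstrIdeal.inter, Set.mem_inter_iff, Set.mem_sdiff, Set.mem_iUnion,
        Finset.mem_union]
      grind
    · intro Z hZ
      rcases Finset.mem_union.1 hZ with h | h
      exacts [hF Z h, hF' Z h]
  pre := by
    classical
    rintro χ g h _ ⟨X, F, rfl, hX, hF⟩
    refine ⟨g.pre X, F.image g.pre, ?_, hX, ?_⟩
    · ext s
      simp only [InvHull.preSet, InvHull.pre, Set.mem_sdiff, Set.mem_iUnion, Set.mem_ofPred_eq,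
        Finset.mem_image, exists_prop]
      constructor
      · rintro ⟨t, ⟨ht, hn⟩, hs⟩
        refine ⟨⟨t, ht, hs⟩, ?_⟩
        rintro ⟨_, ⟨Y, hY, rfl⟩, t', ht', hs'⟩
        rw [hs, Option.some.injEq] at hs'
        subst hs'
        exact hn ⟨Y, hY, ht'⟩
      · rintro ⟨⟨t, ht, hs⟩, hn⟩
        refine ⟨t, ⟨ht, ?_⟩, hs⟩
        rintro ⟨Y, hY, htY⟩
        exact hn ⟨_, ⟨Y, hY, rfl⟩, t, htY, hs⟩
    · intro Z hZ
      obtain ⟨Y, hY, rfl⟩ := Finset.mem_image.1 hZ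
      exact hF Y hY

/-- Auxiliary: `g` and `h` agree on a set belonging to `N χ`. -/
def GermEq (N : SemiChar S → Set S → Prop) (χ : SemiChar S) (g h : InvHull S) : Prop :=
  ∃ A, N χ A ∧ Set.EqOn g.1 h.1 A

namespace GermSys

variable {N : SemiChar S → Set S → Prop}

theorem refl (hN : GermSys N) (χ : SemiChar S) (g : InvHull S) : GermEq N χ g g :=
  ⟨_, hN.ideal χ ConstrIdeal.univ χ.univ_eq, fun _ _ => rfl⟩

theorem trans (hN : GermSys N) {χ : SemiChar S} {g h k : InvHull S} (h1 : GermEq N χ g h) (h2 : GermEq N χ h k) :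
    GermEq N χ g k := by
  obtain ⟨A, hA, e⟩ := h1
  obtain ⟨B, hB, e'⟩ := h2
  exact ⟨_, hN.inter χ A B hA hB, fun s hs => (e hs.1).trans (e' hs.2)⟩

theorem mul (hN : GermSys N) {ψ : SemiChar S} {g g' h h' : InvHull S} (hh : ψ.1 h.dom = true)
    (h1 : GermEq N (act h ψ hh) g g') (h2 : GermEq N ψ h h') :
    GermEq N ψ (g.mul h) (g'.mul h') := by
  obtain ⟨A, hA, e⟩ := h1
  obtain ⟨B, hB, e'⟩ := h2
  refine ⟨_, hN.inter ψ _ _ (hN.pre ψ h hh A hA) hB, ?_⟩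
  rintro s ⟨⟨t, ht, hs⟩, hsB⟩
  have hs' : h'.1 s = some t := by rw [← e' hsB, hs]
  change (h.1 s).bind g.1 = (h'.1 s).bind g'.1
  rw [hs, hs']
  exact e ht

theorem inv (hN : GermSys N) {χ : SemiChar S} {g h : InvHull S} (hg : χ.1 g.dom = true)
    (h1 : GermEq N χ g h) : GermEq N (act g χ hg) g.inv h.inv := by
  obtain ⟨A, hA, e⟩ := h1
  refine ⟨g.inv.preSet A, hN.pre _ _ (χ.act_inv_dom g hg) A ?_, ?_⟩
  · rw [χ.act_inv_act g hg]; exact hA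
  · rintro t ⟨a, ha, h2⟩
    have h3 : g.1 a = some t := (PEquiv.eq_some_iff g.1).1 h2
    have h4 : h.1 a = some t := by rw [← e ha, h3]
    exact h2.trans ((PEquiv.eq_some_iff h.1).2 h4).symm

end GermSys

theorem GermEq.symm {N : SemiChar S → Set S → Prop} {χ : SemiChar S} {g h : InvHull S}
    (h1 : GermEq N χ g h) : GermEq N χ h g :=
  let ⟨A, hA, e⟩ := h1
  ⟨A, hA, e.symm⟩

theorem act_eq_of_germEq {χ : SemiChar S} {g h : InvHull S} (hg : χ.1 g.dom = true)
    (hh : χ.1 h.dom = true) (e : GermEq Holds χ g h) : act g χ hg = act h χ hh := by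
  obtain ⟨_, ⟨X, rfl, hX⟩, e⟩ := e
  refine Subtype.ext (funext fun Y => ?_)
  have key : (g.pre Y).inter X = (h.pre Y).inter X := by
    apply Subtype.ext
    ext s
    simp only [ConstrIdeal.inter, InvHull.pre, InvHull.preSet, Set.mem_inter_iff,
      Set.mem_ofPred_eq]
    refine and_congr_left fun hs => ?_
    rw [e hs]
  have h2 := congrArg χ.1 key
  rw [χ.2.1, χ.2.1, hX, Bool.and_true, Bool.and_true] at h2
  exact h2

end SemiChar

variable (S) in
/-- The set `Σ` of pairs `(g, χ)` with `χ(g⁻¹g) = 1`. -/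
def GermPair : Type u := {p : InvHull S × SemiChar S // p.2.1 p.1.dom = true}

variable (S) in
/-- `(g₁, χ₁) ∼_P (g₂, χ₂)`: `χ₁ = χ₂` and `g₁ p_X = g₂ p_X` for some `X` with `χ₁(p_X) = 1`. -/
def patersonSetoid : Setoid (GermPair S) where
  r a b := a.1.2 = b.1.2 ∧ ∃ X : ConstrIdeal S, Set.EqOn a.1.1.1 b.1.1.1 X.1 ∧ a.1.2.1 X = true
  iseqv :=
    { refl := fun a => ⟨rfl, ConstrIdeal.univ, fun _ _ => rfl, a.1.2.univ_eq⟩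
      symm := by
        rintro a b ⟨h, X, e, hX⟩
        exact ⟨h.symm, X, e.symm, h ▸ hX⟩
      trans := by
        rintro a b c ⟨h, X, e, hX⟩ ⟨h', Y, e', hY⟩
        exact ⟨h.trans h', X.inter Y, fun _ hs => (e hs.1).trans (e' hs.2),
          (SemiChar.inter_eq_true _ X Y).2 ⟨hX, h.symm ▸ hY⟩⟩ }

variable (S) in
/-- The groupoid `𝒢(I_ℓ(S)) = Σ / ∼_P`. -/
def Paterson : Type u := Quotient (patersonSetoid S)

namespace Paterson

/-- The class `[g, χ]`. -/
def mk (g : InvHull S) (χ : SemiChar S) (h : χ.1 g.dom = true) : Paterson S :=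
  Quotient.mk (patersonSetoid S) ⟨(g, χ), h⟩

theorem exists_rep (a : Paterson S) : ∃ g χ h, a = mk g χ h := by
  induction a using Quotient.inductionOn with
  | h a => exact ⟨a.1.1, a.1.2, a.2, rfl⟩

theorem mk_eq_iff (g g' : InvHull S) (χ : SemiChar S) (h : χ.1 g.dom = true)
    (h' : χ.1 g'.dom = true) : mk g χ h = mk g' χ h' ↔ SemiChar.GermEq SemiChar.Holds χ g g' := by
  refine Quotient.eq.trans ⟨?_, ?_⟩
  · rintro ⟨_, X, e, hX⟩; exact ⟨X.1, ⟨X, rfl, hX⟩, e⟩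
  · rintro ⟨_, ⟨X, rfl, hX⟩, e⟩; exact ⟨rfl, X, e, hX⟩

/-- The source `s([g, χ]) = χ`. -/
def src (a : Paterson S) : SemiChar S :=
  Quotient.lift (fun a : GermPair S => a.1.2) (by rintro a b ⟨h, _⟩; exact h) a

/-- The range `r([g, χ]) = χ(g⁻¹ · g)`. -/
def rng (a : Paterson S) : SemiChar S :=
  Quotient.lift (fun a : GermPair S => SemiChar.act a.1.1 a.1.2 a.2) (by
    rintro ⟨⟨g, χ⟩, h⟩ ⟨⟨g', χ'⟩, h'⟩ ⟨e, X, e', hX⟩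
    change χ = χ' at e
    subst e
    exact SemiChar.act_eq_of_germEq h h' ⟨X.1, ⟨X, rfl, hX⟩, e'⟩) a

theorem src_mk (g : InvHull S) (χ : SemiChar S) (h : χ.1 g.dom = true) : (mk g χ h).src = χ := rfl

theorem rng_mk (g : InvHull S) (χ : SemiChar S) (h : χ.1 g.dom = true) :
    (mk g χ h).rng = SemiChar.act g χ h := rfl

theorem exists_rep_of_src {a : Paterson S} {χ : SemiChar S} (h : a.src = χ) :
    ∃ g hg, a = mk g χ hg := by
  obtain ⟨g, χ', hg, rfl⟩ := a.exists_rep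
  rw [src_mk] at h
  subst h
  exact ⟨g, hg, rfl⟩

theorem out_spec (a : Paterson S) : mk a.out.1.1 a.out.1.2 a.out.2 = a := Quotient.out_eq a

theorem out_src (a : Paterson S) : a.out.1.2 = a.src := congrArg src a.out_spec

theorem out_rng (a : Paterson S) : SemiChar.act a.out.1.1 a.out.1.2 a.out.2 = a.rng :=
  congrArg rng a.out_spec

/-- The unit `[p_S, χ]`. -/
noncomputable def unit (χ : SemiChar S) : Paterson S :=
  mk InvHull.one χ (by rw [InvHull.one, InvHull.ofElem_dom]; exact χ.univ_eq)

/-- The product `[g, χ] [h, ψ] = [gh, ψ]`, where `χ = ψ(h⁻¹ · h)`. It is computed on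
representatives; `mul_mk` shows that the choice does not matter. -/
noncomputable def mul (a b : Paterson S) (h : a.src = b.rng) : Paterson S :=
  mk (a.out.1.1.mul b.out.1.1) b.out.1.2 (SemiChar.mul_dom _ _ _ b.out.2 (by
    rw [out_rng, ← h, ← out_src]; exact a.out.2))

theorem mul_mk (g h : InvHull S) (χ ψ : SemiChar S) (hg : χ.1 g.dom = true)
    (hh : ψ.1 h.dom = true) (e : χ = SemiChar.act h ψ hh) :
    mul (mk g χ hg) (mk h ψ hh) e =
      mk (g.mul h) ψ (SemiChar.mul_dom _ _ _ hh (e ▸ hg)) := by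
  subst e
  have key : ∀ (a b : GermPair S) (_ : mk a.1.1 a.1.2 a.2 = mk g _ hg)
      (_ : mk b.1.1 b.1.2 b.2 = mk h ψ hh) (p : b.1.2.1 (a.1.1.mul b.1.1).dom = true),
      mk (a.1.1.mul b.1.1) b.1.2 p =
        mk (g.mul h) ψ (SemiChar.mul_dom _ _ _ hh hg) := by
    rintro ⟨⟨g', χ'⟩, hg'⟩ ⟨⟨h', ψ'⟩, hh'⟩ e1 e2 p
    have e3 : χ' = _ := congrArg src e1
    have e4 : ψ' = ψ := congrArg src e2
    subst e4
    subst e3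
    have e1' := (mk_eq_iff _ _ _ _ _).1 e1
    have e2' := (mk_eq_iff _ _ _ _ _).1 e2
    exact (mk_eq_iff _ _ _ _ _).2 (SemiChar.germSys_holds.mul hh e1'.symm e2'.symm).symm
  exact key _ _ (out_spec _) (out_spec _) _

/-- The inverse `[g, χ]⁻¹ = [g⁻¹, χ(g⁻¹ · g)]`, computed on a representative. -/
noncomputable def inv (a : Paterson S) : Paterson S :=
  mk a.out.1.1.inv (SemiChar.act a.out.1.1 a.out.1.2 a.out.2) (SemiChar.act_inv_dom _ _ _)

theorem inv_mk (g : InvHull S) (χ : SemiChar S) (hg : χ.1 g.dom = true) :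
    inv (mk g χ hg) = mk g.inv (SemiChar.act g χ hg) (SemiChar.act_inv_dom _ _ _) := by
  have key : ∀ (a : GermPair S) (_ : mk a.1.1 a.1.2 a.2 = mk g _ hg)
      (p : (SemiChar.act a.1.1 a.1.2 a.2).1 a.1.1.inv.dom = true),
      mk a.1.1.inv (SemiChar.act a.1.1 a.1.2 a.2) p =
        mk g.inv (SemiChar.act g χ hg) (SemiChar.act_inv_dom _ _ _) := by
    rintro ⟨⟨g', χ'⟩, hg'⟩ e1 p
    have e3 : χ' = _ := congrArg src e1
    subst e3
    have e4 : SemiChar.act g' χ' hg' = SemiChar.act g χ' hg := congrArg rng e1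
    rw [mk_eq_iff] at e1
    have e5 := SemiChar.germSys_holds.inv hg' e1
    have : ∀ (η : SemiChar S) (_ : η = SemiChar.act g χ' hg) (q : η.1 g'.inv.dom = true)
        (_ : SemiChar.GermEq SemiChar.Holds η g'.inv g.inv), mk g'.inv η q =
          mk g.inv (SemiChar.act g χ' hg) (SemiChar.act_inv_dom _ _ _) := by
      rintro _ rfl q e
      exact (mk_eq_iff _ _ _ _ _).2 e
    exact this _ e4 _ e5
  exact key _ (out_spec _) _

theorem mk_congr {g g' : InvHull S} {χ χ' : SemiChar S} (e : g = g') (e' : χ = χ')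
    (h : χ.1 g.dom = true) : mk g χ h = mk g' χ' (by rw [← e, ← e']; exact h) := by
  subst e; subst e'; rfl

noncomputable instance : Grpd (SemiChar S) (Paterson S) where
  src := src
  rng := rng
  unit := unit
  inv := inv
  mul := mul
  src_unit _ := rfl
  rng_unit χ := χ.act_one (by rw [InvHull.one, InvHull.ofElem_dom]; exact χ.univ_eq)
  src_inv a := a.out_rng
  rng_inv a := by
    obtain ⟨g, χ, h, rfl⟩ := a.exists_rep
    rw [inv_mk, rng_mk, SemiChar.act_inv_act, src_mk]
  src_mul a b h := b.out_src
  rng_mul a b h := by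
    obtain ⟨k, ψ, hk, rfl⟩ := b.exists_rep
    obtain ⟨g, hg, rfl⟩ := exists_rep_of_src (χ := SemiChar.act k ψ hk) h
    rw [mul_mk _ _ _ _ _ _ rfl]
    exact SemiChar.act_mul ψ g k hk hg
  mul_assoc a b c h h' := by
    obtain ⟨m, χ, hm, rfl⟩ := c.exists_rep
    obtain ⟨k, hk, rfl⟩ := exists_rep_of_src (χ := SemiChar.act m χ hm) h'
    obtain ⟨g, hg, rfl⟩ := exists_rep_of_src (χ := SemiChar.act k _ hk) h
    have e1 := mul_mk g k _ _ hg hk rfl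
    have e2 := mul_mk k m _ _ hk hm rfl
    have e3 : ∀ (x : Paterson S) (_ : x = mk (g.mul k) (SemiChar.act m χ hm)
        (SemiChar.mul_dom _ _ _ hk hg)) (p : x.src = (mk m χ hm).rng),
        mul x (mk m χ hm) p = mk ((g.mul k).mul m) χ
          (SemiChar.mul_dom _ _ _ hm (SemiChar.mul_dom _ _ _ hk hg)) := by
      rintro _ rfl p
      exact mul_mk _ _ _ _ _ _ rfl
    have e4 : ∀ (x : Paterson S) (_ : x = mk (k.mul m) χ (SemiChar.mul_dom _ _ _ hm hk))
        (p : (mk g _ hg).src = x.rng),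
        mul (mk g _ hg) x p = mk (g.mul (k.mul m)) χ
          (SemiChar.mul_dom _ _ _ (SemiChar.mul_dom _ _ _ hm hk)
            (by rw [SemiChar.act_mul]; exact hg)) := by
      rintro _ rfl p
      exact mul_mk _ _ _ _ _ _ p
    rw [e3 _ e1, e4 _ e2]
    exact mk_congr (Subtype.ext (PEquiv.trans_assoc _ _ _).symm) rfl _
  mul_unit a := by
    obtain ⟨g, χ, h, rfl⟩ := a.exists_rep
    refine (mul_mk g InvHull.one χ χ h _ (χ.act_one _).symm).trans ?_
    refine mk_congr (Subtype.ext ?_) rfl _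
    change InvHull.one.1.trans g.1 = g.1
    rw [InvHull.one_val, PEquiv.refl_trans]
  unit_mul a := by
    obtain ⟨g, χ, h, rfl⟩ := a.exists_rep
    refine (mul_mk InvHull.one g _ χ _ h rfl).trans ?_
    refine mk_congr (Subtype.ext ?_) rfl _
    change g.1.trans InvHull.one.1 = g.1
    rw [InvHull.one_val, PEquiv.trans_refl]
  inv_mul a := by
    obtain ⟨g, χ, h, rfl⟩ := a.exists_rep
    have e : ∀ (x : Paterson S)
        (_ : x = mk g.inv (SemiChar.act g χ h) (SemiChar.act_inv_dom _ _ _)) (p : x.src = (mk g χ h).rng),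
        mul x (mk g χ h) p = mk (g.inv.mul g) χ
          (SemiChar.mul_dom _ _ _ h (SemiChar.act_inv_dom _ _ _)) := by
      rintro _ rfl p
      exact mul_mk _ _ _ _ _ _ rfl
    refine (e _ (inv_mk g χ h) _).trans ?_
    refine (mk_eq_iff _ _ _ _ _).2 ⟨_, ⟨g.dom, rfl, h⟩, fun s hs => ?_⟩
    obtain ⟨t, ht⟩ := Option.isSome_iff_exists.1 hs
    change (g.1 s).bind g.1.symm = InvHull.one.1 s
    rw [ht, InvHull.one_val, PEquiv.refl_apply]
    exact (PEquiv.eq_some_iff g.1).2 ht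
  mul_inv a := by
    obtain ⟨g, χ, h, rfl⟩ := a.exists_rep
    have e : ∀ (x : Paterson S)
        (_ : x = mk g.inv (SemiChar.act g χ h) (SemiChar.act_inv_dom _ _ _)) (p : (mk g χ h).src = x.rng),
        mul (mk g χ h) x p = mk (g.mul g.inv) (SemiChar.act g χ h)
          (SemiChar.mul_dom _ _ _ (SemiChar.act_inv_dom _ _ _)
            (by rw [SemiChar.act_inv_act]; exact h)) := by
      rintro _ rfl p
      exact mul_mk _ _ _ _ _ _ p
    refine (e _ (inv_mk g χ h) _).trans ?_
    refine (mk_eq_iff _ _ _ _ _).2 ⟨_, ⟨g.inv.dom, rfl, SemiChar.act_inv_dom _ _ _⟩,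
      fun s hs => ?_⟩
    obtain ⟨t, ht⟩ := Option.isSome_iff_exists.1 hs
    change (g.1.symm s).bind g.1 = InvHull.one.1 s
    have ht' : g.1.symm s = some t := ht
    rw [ht', InvHull.one_val, PEquiv.refl_apply]
    exact (PEquiv.eq_some_iff g.1).1 ht

/-- `D(g, U) = {[g, χ] | χ ∈ U}`. -/
def basicSet (g : InvHull S) (U : Set (SemiChar S)) : Set (Paterson S) :=
  {a | ∃ χ h, χ ∈ U ∧ a = mk g χ h}

/-- The topology with basis the sets `D(g, U)`, `U ⊆ {χ | χ(g⁻¹g) = 1}` open. -/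
instance : TopologicalSpace (Paterson S) :=
  TopologicalSpace.generateFrom
    {D | ∃ (g : InvHull S) (U : Set (SemiChar S)), IsOpen U ∧ U ⊆ {χ | χ.1 g.dom = true} ∧
      D = basicSet g U}

end Paterson

variable (S) in
/-- `Ω(S)`: the closure of the orbit of `χ_e`, that is, of `{χ_s | s ∈ S}`. -/
def omegaSet : Set (SemiChar S) := closure (Set.range SemiChar.point)

theorem point_mem_omegaSet (s : S) : SemiChar.point s ∈ omegaSet S := subset_closure ⟨s, rfl⟩

theorem mem_omegaSet_iff (χ : SemiChar S) :
    χ ∈ omegaSet S ↔ ∀ F : Finset (ConstrIdeal S), ∃ s, ∀ Y ∈ F, (χ.1 Y = true ↔ s ∈ Y.1) := by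
  rw [omegaSet, mem_closure_iff]
  constructor
  · intro h F
    obtain ⟨_, h1, s, rfl⟩ := h (⋂ Y ∈ F, {ψ : SemiChar S | ψ.1 Y = χ.1 Y})
      (isOpen_biInter_finset fun Y _ => (isOpen_discrete ({χ.1 Y} : Set Bool)).preimage
        (f := fun ψ : SemiChar S => ψ.1 Y) ((continuous_apply Y).comp continuous_subtype_val)) (by simp)
    refine ⟨s, fun Y hY => ?_⟩
    rw [← SemiChar.point_eq_true]
    have : (SemiChar.point s).1 Y = χ.1 Y := by simpa using Set.mem_iInter₂.1 h1 Y hY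
    rw [this]
  · intro h o ho hχ
    obtain ⟨u, hu, rfl⟩ := isOpen_induced_iff.1 ho
    obtain ⟨F, v, hv, hv'⟩ := isOpen_pi_iff.1 hu χ.1 hχ
    obtain ⟨s, hs⟩ := h F
    refine ⟨SemiChar.point s, hv' fun Y hY => ?_, s, rfl⟩
    have : (SemiChar.point s).1 Y = χ.1 Y := by
      rw [Bool.eq_iff_iff, SemiChar.point_eq_true, hs Y hY]
    rw [this]
    exact (hv Y hY).2

theorem act_mem_omegaSet {χ : SemiChar S} (hχ : χ ∈ omegaSet S) (g : InvHull S)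
    (h : χ.1 g.dom = true) : SemiChar.act g χ h ∈ omegaSet S := by
  classical
  rw [mem_omegaSet_iff] at hχ ⊢
  intro F
  obtain ⟨s, hs⟩ := hχ (insert g.dom (F.image g.pre))
  have h1 := (hs g.dom (Finset.mem_insert_self _ _)).1 h
  obtain ⟨t, ht⟩ := Option.isSome_iff_exists.1 h1
  refine ⟨t, fun Y hY => (hs (g.pre Y)
    (Finset.mem_insert_of_mem (Finset.mem_image_of_mem _ hY))).trans ?_⟩
  constructor
  · rintro ⟨t', ht', e⟩
    rw [ht, Option.some.injEq] at e
    subst e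
    exact ht'
  · exact fun hY => ⟨t, hY, ht⟩

theorem Paterson.rng_mem_omegaSet (a : Paterson S) (h : Grpd.src a ∈ omegaSet S) :
    Grpd.rng a ∈ omegaSet S := by
  obtain ⟨g, χ, hg, rfl⟩ := a.exists_rep
  exact act_mem_omegaSet h g hg

/-- The orbit of `χ_e` is `{χ_s | s ∈ S}`. -/
theorem orbit_point_one :
    {χ | ∃ a : Paterson S, Grpd.src a = SemiChar.point 1 ∧ Grpd.rng a = χ} =
      Set.range (SemiChar.point (S := S)) := by
  have key : ∀ (g : InvHull S) (h : (SemiChar.point (1 : S)).1 g.dom = true) (s : S),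
      g.1 1 = some s → SemiChar.act g (SemiChar.point 1) h = SemiChar.point s := by
    intro g h s hs
    refine Subtype.ext (funext fun X => ?_)
    rw [Bool.eq_iff_iff, SemiChar.point_eq_true]
    refine (SemiChar.point_eq_true _ _).trans ?_
    constructor
    · rintro ⟨t, ht, e⟩
      rw [hs, Option.some.injEq] at e
      subst e
      exact ht
    · exact fun hX => ⟨s, hX, hs⟩
  ext χ
  constructor
  · rintro ⟨a, h, rfl⟩
    obtain ⟨g, hg, rfl⟩ := Paterson.exists_rep_of_src h
    obtain ⟨s, hs⟩ := Option.isSome_iff_exists.1 ((SemiChar.point_eq_true _ _).1 hg)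
    exact ⟨s, (key g hg s hs).symm⟩
  · rintro ⟨s, rfl⟩
    refine ⟨Paterson.mk (InvHull.ofElem s) (SemiChar.point 1)
      (by rw [InvHull.ofElem_dom]; exact SemiChar.univ_eq _), rfl,
        key (InvHull.ofElem s) (by rw [InvHull.ofElem_dom]; exact SemiChar.univ_eq _) s ?_⟩
    simp [InvHull.ofElem, leftTranslation_apply]

variable (S) in
/-- The groupoid `𝒢_P(S)`: the reduction of `𝒢(I_ℓ(S))` to `Ω(S)`, with the relative topology. -/
abbrev GroupoidP : Type u := {a : Paterson S // Grpd.src a ∈ omegaSet S}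

noncomputable instance : Grpd (omegaSet S) (GroupoidP S) :=
  Grpd.reduction (omegaSet S) Paterson.rng_mem_omegaSet

namespace GroupoidP

/-- The class `[g, χ]`, for `χ ∈ Ω(S)`. -/
def mk (g : InvHull S) (χ : SemiChar S) (hχ : χ ∈ omegaSet S) (h : χ.1 g.dom = true) :
    GroupoidP S := ⟨Paterson.mk g χ h, hχ⟩

theorem exists_rep (a : GroupoidP S) : ∃ g χ hχ h, a = mk g χ hχ h := by
  obtain ⟨g, χ, h, e⟩ := a.1.exists_rep
  have e' : Grpd.src a.1 = χ := congrArg Paterson.src e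
  exact ⟨g, χ, e' ▸ a.2, h, Subtype.ext e⟩

/-- `[g, χ] ∼ [h, χ]`: there is a set `A = X \ (X₁ ∪ ⋯ ∪ X_m)` with `χ(p_A) = 1` and
`g|_A = h|_A`. -/
def Rel (a b : GroupoidP S) : Prop :=
  ∃ (χ : SemiChar S) (hχ : χ ∈ omegaSet S) (g h : InvHull S) (hg : χ.1 g.dom = true)
    (hh : χ.1 h.dom = true), a = mk g χ hχ hg ∧ b = mk h χ hχ hh ∧
      ∃ A, χ.HoldsExt A ∧ Set.EqOn g.1 h.1 A

theorem holds_to_ext {χ : SemiChar S} {g h : InvHull S}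
    (e : SemiChar.GermEq SemiChar.Holds χ g h) : SemiChar.GermEq SemiChar.HoldsExt χ g h := by
  obtain ⟨_, ⟨X, rfl, hX⟩, e⟩ := e
  exact ⟨X.1, SemiChar.germSys_holdsExt.ideal χ X hX, e⟩

theorem rel_mk_iff (g h : InvHull S) (χ : SemiChar S) (hχ : χ ∈ omegaSet S)
    (hg : χ.1 g.dom = true) (hh : χ.1 h.dom = true) :
    Rel (mk g χ hχ hg) (mk h χ hχ hh) ↔ ∃ A, χ.HoldsExt A ∧ Set.EqOn g.1 h.1 A := by
  constructor
  · rintro ⟨χ', hχ', g', h', hg', hh', e1, e2, e3⟩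
    have e4 : χ = χ' := congrArg (fun a : GroupoidP S => a.1.src) e1
    subst e4
    have e5 := (Paterson.mk_eq_iff _ _ _ _ _).1 (congrArg Subtype.val e1)
    have e6 := (Paterson.mk_eq_iff _ _ _ _ _).1 (congrArg Subtype.val e2)
    have G := SemiChar.germSys_holdsExt (S := S)
    exact G.trans (G.trans (holds_to_ext e5) e3) (holds_to_ext e6).symm
  · exact fun e => ⟨χ, hχ, g, h, hg, hh, rfl, rfl, e⟩

variable (S) in
/-- The equivalence relation `∼` on `𝒢_P(S)`. -/
def setoid : Setoid (GroupoidP S) where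
  r := Rel
  iseqv :=
    { refl := fun a => by
        obtain ⟨g, χ, hχ, h, rfl⟩ := a.exists_rep
        exact (rel_mk_iff _ _ _ _ _ _).2 (SemiChar.germSys_holdsExt.refl χ g)
      symm := by
        rintro _ _ ⟨χ, hχ, g, h, hg, hh, rfl, rfl, e⟩
        exact (rel_mk_iff _ _ _ _ _ _).2 (SemiChar.GermEq.symm e)
      trans := by
        rintro _ b c ⟨χ, hχ, g, h, hg, hh, rfl, rfl, e⟩ ⟨χ', hχ', g', h', hg', hh', e1, rfl, e3⟩
        have e4 : χ = χ' := congrArg (fun a : GroupoidP S => a.1.src) e1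
        subst e4
        have e5 := (Paterson.mk_eq_iff _ _ _ _ _).1 (congrArg Subtype.val e1)
        have G := SemiChar.germSys_holdsExt (S := S)
        exact (rel_mk_iff _ _ _ _ _ _).2 (G.trans (G.trans e (holds_to_ext e5)) e3) }

theorem act_eq_of_ext {χ : SemiChar S} (hχ : χ ∈ omegaSet S) {g h : InvHull S}
    (hg : χ.1 g.dom = true) (hh : χ.1 h.dom = true)
    (e : SemiChar.GermEq SemiChar.HoldsExt χ g h) :
    SemiChar.act g χ hg = SemiChar.act h χ hh := by
  classical
  obtain ⟨_, ⟨X, F, rfl, hX, hF⟩, e⟩ := e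
  refine Subtype.ext (funext fun Y => ?_)
  obtain ⟨s, hs⟩ := (mem_omegaSet_iff χ).1 hχ (insert X (insert (g.pre Y) (insert (h.pre Y) F)))
  have hsA : s ∈ X.1 \ ⋃ Y ∈ F, Y.1 := by
    refine ⟨(hs X (by simp)).1 hX, ?_⟩
    intro hmem
    obtain ⟨Z, hZ, hsZ⟩ := Set.mem_iUnion₂.1 hmem
    have := (hs Z (by simp [hZ])).2 hsZ
    rw [hF Z hZ] at this
    exact Bool.noConfusion this
  rw [Bool.eq_iff_iff]
  refine (hs (g.pre Y) (by simp)).trans (Iff.trans ?_ (hs (h.pre Y) (by simp)).symm)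
  simp only [InvHull.pre, InvHull.preSet, Set.mem_ofPred_eq]
  rw [e hsA]

theorem src_eq_of_rel {a b : GroupoidP S} (h : Rel a b) : Grpd.src a = Grpd.src b := by
  obtain ⟨χ, hχ, g, h, hg, hh, rfl, rfl, e⟩ := h
  rfl

theorem rng_eq_of_rel {a b : GroupoidP S} (h : Rel a b) : Grpd.rng a = Grpd.rng b := by
  obtain ⟨χ, hχ, g, h, hg, hh, rfl, rfl, e⟩ := h
  exact Subtype.ext (act_eq_of_ext hχ hg hh e)

theorem mul_rel {a b a' b' : GroupoidP S} (h1 : Rel a a') (h2 : Rel b b')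
    (h : Grpd.src a = Grpd.rng b) (h' : Grpd.src a' = Grpd.rng b') :
    Rel (Grpd.mul a b h) (Grpd.mul a' b' h') := by
  obtain ⟨ψ, hψ, k, k', hk, hk', rfl, rfl, e2⟩ := h2
  obtain ⟨χ, hχ, g, g', hg, hg', rfl, rfl, e1⟩ := h1
  have hc : χ = SemiChar.act k ψ hk := congrArg Subtype.val h
  have hc' : χ = SemiChar.act k' ψ hk' := congrArg Subtype.val h'
  refine ⟨ψ, hψ, g.mul k, g'.mul k', SemiChar.mul_dom _ _ _ hk (hc ▸ hg),
    SemiChar.mul_dom _ _ _ hk' (hc' ▸ hg'), Subtype.ext (Paterson.mul_mk _ _ _ _ _ _ hc),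
    Subtype.ext (Paterson.mul_mk _ _ _ _ _ _ hc'), ?_⟩
  subst hc
  exact SemiChar.germSys_holdsExt.mul hk e1 e2

theorem inv_rel {a b : GroupoidP S} (h : Rel a b) : Rel (Grpd.inv a) (Grpd.inv b) := by
  obtain ⟨χ, hχ, g, h, hg, hh, rfl, rfl, e⟩ := h
  have e' := act_eq_of_ext hχ hg hh e
  refine ⟨SemiChar.act g χ hg, act_mem_omegaSet hχ g hg, g.inv, h.inv, SemiChar.act_inv_dom _ _ _,
    e' ▸ SemiChar.act_inv_dom _ _ _, Subtype.ext (Paterson.inv_mk _ _ _),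
    Subtype.ext ((Paterson.inv_mk _ _ _).trans (Paterson.mk_congr rfl e'.symm _)),
    SemiChar.germSys_holdsExt.inv hg e⟩

end GroupoidP

variable (S) in
/-- The quotient groupoid `𝒢(S) = 𝒢_P(S) / ∼`. -/
def GroupoidQ : Type u := Quotient (GroupoidP.setoid S)

/-- The quotient map `𝒢_P(S) → 𝒢(S)`. -/
def GroupoidP.toQ (a : GroupoidP S) : GroupoidQ S := Quotient.mk (GroupoidP.setoid S) a

namespace GroupoidQ

/-- The quotient topology. -/
instance : TopologicalSpace (GroupoidQ S) :=
  inferInstanceAs (TopologicalSpace (Quotient (GroupoidP.setoid S)))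

theorem out_spec (a : GroupoidQ S) : a.out.toQ = a := Quotient.out_eq a

theorem toQ_eq_iff (a b : GroupoidP S) : a.toQ = b.toQ ↔ GroupoidP.Rel a b :=
  Quotient.eq (r := GroupoidP.setoid S)

theorem out_rel (a : GroupoidP S) : GroupoidP.Rel a.toQ.out a := (toQ_eq_iff _ _).1 (out_spec _)

theorem exists_rep (a : GroupoidQ S) : ∃ b : GroupoidP S, a = b.toQ := ⟨_, a.out_spec.symm⟩

/-- The source map induced from `𝒢_P(S)`. -/
noncomputable def src (a : GroupoidQ S) : omegaSet S :=
  Quotient.lift (fun a : GroupoidP S => Grpd.src a) (fun _ _ h => GroupoidP.src_eq_of_rel h) a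

/-- The range map induced from `𝒢_P(S)`. -/
noncomputable def rng (a : GroupoidQ S) : omegaSet S :=
  Quotient.lift (fun a : GroupoidP S => Grpd.rng a) (fun _ _ h => GroupoidP.rng_eq_of_rel h) a

/-- The inverse, computed on a representative. -/
noncomputable def inv (a : GroupoidQ S) : GroupoidQ S := (Grpd.inv a.out).toQ

/-- The product, computed on representatives; `mul_toQ` shows that the choice does not matter. -/
noncomputable def mul (a b : GroupoidQ S) (h : a.src = b.rng) : GroupoidQ S :=
  (Grpd.mul a.out b.out (by
    have h1 : Grpd.src a.out = a.src := congrArg src a.out_spec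
    have h2 : Grpd.rng b.out = b.rng := congrArg rng b.out_spec
    rw [h1, h2, h])).toQ

theorem mul_toQ (a b : GroupoidP S) (h : Grpd.src a = Grpd.rng b) :
    mul a.toQ b.toQ h = (Grpd.mul a b h).toQ :=
  (toQ_eq_iff _ _).2 (GroupoidP.mul_rel (out_rel a) (out_rel b) _ _)

theorem inv_toQ (a : GroupoidP S) : inv a.toQ = (Grpd.inv a).toQ :=
  (toQ_eq_iff _ _).2 (GroupoidP.inv_rel (out_rel a))

theorem mul_congr {a a' b b' : GroupoidQ S} (e : a = a') (e' : b = b') (h : a.src = b.rng) :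
    mul a b h = mul a' b' (by rw [← e, ← e', h]) := by subst e; subst e'; rfl

noncomputable instance : Grpd (omegaSet S) (GroupoidQ S) where
  src := src
  rng := rng
  unit x := (Grpd.unit x : GroupoidP S).toQ
  inv := inv
  mul := mul
  src_unit x := Grpd.src_unit (G := GroupoidP S) x
  rng_unit x := Grpd.rng_unit (G := GroupoidP S) x
  src_inv a := by
    obtain ⟨a, rfl⟩ := a.exists_rep
    rw [inv_toQ]; exact Grpd.src_inv a
  rng_inv a := by
    obtain ⟨a, rfl⟩ := a.exists_rep
    rw [inv_toQ]; exact Grpd.rng_inv a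
  src_mul a b h := by
    obtain ⟨a, rfl⟩ := a.exists_rep
    obtain ⟨b, rfl⟩ := b.exists_rep
    rw [mul_toQ _ _ h]; exact Grpd.src_mul a b h
  rng_mul a b h := by
    obtain ⟨a, rfl⟩ := a.exists_rep
    obtain ⟨b, rfl⟩ := b.exists_rep
    rw [mul_toQ _ _ h]; exact Grpd.rng_mul a b h
  mul_assoc a b c h h' := by
    obtain ⟨a, rfl⟩ := a.exists_rep
    obtain ⟨b, rfl⟩ := b.exists_rep
    obtain ⟨c, rfl⟩ := c.exists_rep
    have h1 : Grpd.src a = Grpd.rng b := h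
    have h2 : Grpd.src b = Grpd.rng c := h'
    rw [mul_congr (mul_toQ a b h1) rfl, mul_congr rfl (mul_toQ b c h2),
      mul_toQ _ _ ((Grpd.src_mul _ _ _).trans h2), mul_toQ _ _ (h1.trans (Grpd.rng_mul _ _ _).symm)]
    exact congrArg _ (Grpd.mul_assoc a b c h1 h2)
  mul_unit a := by
    obtain ⟨a, rfl⟩ := a.exists_rep
    exact (mul_toQ a _ (Grpd.rng_unit _).symm).trans (congrArg _ (Grpd.mul_unit a))
  unit_mul a := by
    obtain ⟨a, rfl⟩ := a.exists_rep
    exact (mul_toQ _ a (Grpd.src_unit _)).trans (congrArg _ (Grpd.unit_mul a))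
  inv_mul a := by
    obtain ⟨a, rfl⟩ := a.exists_rep
    rw [mul_congr (inv_toQ a) rfl, mul_toQ _ _ (Grpd.src_inv a)]
    exact congrArg _ (Grpd.inv_mul a)
  mul_inv a := by
    obtain ⟨a, rfl⟩ := a.exists_rep
    rw [mul_congr rfl (inv_toQ a), mul_toQ _ _ (Grpd.rng_inv a).symm]
    exact congrArg _ (Grpd.mul_inv a)

end GroupoidQ

end paterson

/-! ### The reduced semigroup C*-algebra -/

section semigroup

variable (S : Type u) [LeftCancelMonoid S]

variable {S} in
/-- The elements of `I_ℓ(S)` commute with right multiplications. -/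
theorem MemInvHull.map_mul {g : S ≃. S} (hg : MemInvHull g) :
    ∀ t r u, g t = some u → g (t * r) = some (u * r) := by
  induction hg with
  | left s =>
    intro t r u h
    rw [leftTranslation_apply, Option.some.injEq] at h ⊢
    rw [← h, mul_assoc]
  | symm g hg ih =>
    intro t r u h
    rw [PEquiv.eq_some_iff] at h ⊢
    exact ih _ _ _ h
  | trans g h _ _ ihg ihh =>
    intro t r u e
    rw [PEquiv.trans_eq_some] at e ⊢
    obtain ⟨b, h1, h2⟩ := e
    exact ⟨b * r, ihg _ _ _ h1, ihh _ _ _ h2⟩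

variable {S} in
open Classical in
theorem orthonormal_translate (s : S) :
    Orthonormal ℂ (fun t : S => (lp.single 2 (s * t) (1 : ℂ) : EllTwo S)) := by
  rw [orthonormal_iff_ite]
  intro i j
  rw [lp.inner_single_left]
  simp [lp.single_apply, Pi.single_apply]

open Classical in
/-- The left regular representation `λ_s δ_t = δ_{st}`. -/
noncomputable def leftReg {S : Type u} [LeftCancelMonoid S] (s : S) : EllTwo S →L[ℂ] EllTwo S :=
  (orthonormal_translate s).orthogonalFamily.linearIsometry.toContinuousLinearMap

open Classical in
theorem leftReg_single {S : Type u} [LeftCancelMonoid S] (s t : S) :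
    leftReg s (lp.single 2 t (1 : ℂ)) = lp.single 2 (s * t) (1 : ℂ) := by
  refine ((orthonormal_translate s).orthogonalFamily.linearIsometry_apply_single _).trans ?_
  simp

/-- The reduced C*-algebra `C*_r(S)`, generated by the operators `λ_s`. -/
noncomputable def semigroupCStar : StarSubalgebra ℂ (EllTwo S →L[ℂ] EllTwo S) :=
  (StarAlgebra.adjoin ℂ (Set.range (leftReg (S := S)))).topologicalClosure

/-- `χ_e` as an object of `𝒢_P(S)`. -/
noncomputable def chiE : omegaSet S := ⟨SemiChar.point 1, point_mem_omegaSet 1⟩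

/-- The bijection `S → 𝒢_P(S)_{χ_e}`, `s ↦ [s, χ_e]`. -/
noncomputable def fiberMap (s : S) : SrcFiber (GroupoidP S) (chiE S) :=
  ⟨GroupoidP.mk (InvHull.ofElem s) (SemiChar.point 1) (point_mem_omegaSet 1)
    (by rw [InvHull.ofElem_dom]; exact SemiChar.univ_eq _), rfl⟩

theorem fiberMap_bijective : Function.Bijective (fiberMap S) := by
  constructor
  · intro s t h
    have h1 : (fiberMap S s).1.1 = (fiberMap S t).1.1 := by rw [h]
    obtain ⟨_, ⟨X, rfl, hX⟩, e⟩ := (Paterson.mk_eq_iff _ _ _ _ _).1 h1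
    have := e ((SemiChar.point_eq_true _ _).1 hX)
    simpa [InvHull.ofElem, leftTranslation_apply] using this
  · rintro ⟨a, ha⟩
    obtain ⟨g, χ, hχ, hg, rfl⟩ := a.exists_rep
    have e : χ = SemiChar.point 1 := congrArg Subtype.val ha
    subst e
    obtain ⟨s, hs⟩ := Option.isSome_iff_exists.1 ((SemiChar.point_eq_true _ _).1 hg)
    refine ⟨s, Subtype.ext (Subtype.ext ((Paterson.mk_eq_iff _ _ _ _ _).2 ?_))⟩
    refine ⟨_, SemiChar.germSys_holds.ideal _ ConstrIdeal.univ (SemiChar.univ_eq _), ?_⟩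
    intro t _
    change some (s * t) = g.1 t
    have := MemInvHull.map_mul g.2 1 t s hs
    rw [one_mul] at this
    exact this.symm

/-- The bijection `S ≃ 𝒢_P(S)_{χ_e}`, `s ↦ [s, χ_e]`. -/
noncomputable def fiberEquiv : S ≃ SrcFiber (GroupoidP S) (chiE S) :=
  Equiv.ofBijective (fiberMap S) (fiberMap_bijective S)

/-- The unitary `ℓ²(κ) → ℓ²(ι)`, `ξ ↦ ξ ∘ e`, induced by a bijection `e : ι → κ`. -/
noncomputable def ellTwoCongr {ι κ : Type u} (e : ι ≃ κ) : EllTwo κ ≃ₗᵢ[ℂ] EllTwo ι where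
  toFun ξ := ⟨fun i => ξ (e i), by
    have h := lp.memℓp ξ
    rw [memℓp_gen_iff (by norm_num)] at h
    refine (memℓp_gen_iff (by norm_num)).2 ?_
    exact (e.summable_iff (f := fun k => ‖ξ k‖ ^ (2 : ℝ≥0∞).toReal)).2 h⟩
  invFun ξ := ⟨fun i => ξ (e.symm i), by
    have h := lp.memℓp ξ
    rw [memℓp_gen_iff (by norm_num)] at h
    refine (memℓp_gen_iff (by norm_num)).2 ?_
    exact (e.symm.summable_iff (f := fun k => ‖ξ k‖ ^ (2 : ℝ≥0∞).toReal)).2 h⟩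
  map_add' _ _ := rfl
  map_smul' _ _ := rfl
  left_inv ξ := by ext i; simp
  right_inv ξ := by ext i; simp
  norm_map' ξ := by
    rw [lp.norm_eq_tsum_rpow (by norm_num), lp.norm_eq_tsum_rpow (by norm_num)]
    congr 1
    exact e.tsum_eq (fun k => ‖ξ k‖ ^ (2 : ℝ≥0∞).toReal)

/-- The representation `ρ_{χ_e}` of `C*_r(𝒢_P(S))`, viewed as a representation on `ℓ²(S)` through
the bijection `s ↦ [s, χ_e]`. -/
noncomputable def rhoChiE (a : reducedCStar (GroupoidP S)) : EllTwo S →L[ℂ] EllTwo S :=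
  (ellTwoCongr (fiberEquiv S)).conjStarAlgEquiv (rho (GroupoidP S) (chiE S) a)

/-- `ρ_{χ_e}` defines an isomorphism `C*_r(𝒢_P(S)) ≅ C*_r(S)`. -/
def RhoDefinesIso : Prop :=
  ∃ φ : reducedCStar (GroupoidP S) ≃⋆ₐ[ℂ] semigroupCStar S,
    ∀ a, (φ a : EllTwo S →L[ℂ] EllTwo S) = rhoChiE S a

/-- Strong C*-regularity: whenever `∅ ≠ X \ (X₁ ∪ ⋯ ∪ X_m) ⊆ ⋃_k {s | h_k s = s}`, there are
constructible ideals `Y₁, …, Y_l` covering `X \ (X₁ ∪ ⋯ ∪ X_m)` and indices `k_j` such that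
`h_{k_j} p_{Y_j} = p_{Y_j}`. -/
def StronglyCStarRegular : Prop :=
  ∀ (n m : ℕ) (h : Fin n → InvHull S) (X : ConstrIdeal S) (Xs : Fin m → ConstrIdeal S),
    (X.1 \ ⋃ i, (Xs i).1).Nonempty →
    X.1 \ ⋃ i, (Xs i).1 ⊆ ⋃ k, {s | (h k).1 s = some s} →
    ∃ (l : ℕ) (Y : Fin l → ConstrIdeal S) (k : Fin l → Fin n),
      X.1 \ ⋃ i, (Xs i).1 ⊆ ⋃ j, (Y j).1 ∧ ∀ j, ∀ s ∈ (Y j).1, (h (k j)).1 s = some s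

end semigroup

/-! ### Operators of bisections -/

/-! The quotient map already respects the groupoid structure, and the quotient topology makes it a
quotient map, so everything reduces to injectivity (`isTopIso_toQ`): if `g` and `h` agree on a set
`A = X \ (X₁ ∪ ⋯ ∪ X_m)` with `χ(p_A) = 1` and `χ ∈ Ω(S)`, then `[g, χ] = [h, χ]`.

For the first claim, let `U` be the clopen set of semi-characters that are `1` at `X`, `dom g`, `dom
h` and `0` at every `X_i`. The sets `D(g, U)` and `D(h, U)`, cut down to `Ω(S)`, are compact open
bisections, so their indicators define elements of the reduced C*-algebra. The representation at
`χ_e` sees a function only on arrows whose source lies in the orbit of `χ_e`, that is, is some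
`χ_s`. If `χ_s ∈ U` then `s ∈ A`, hence `gs = hs`; as `g` and `h` commute with right multiplication
they agree on `sS`, a constructible ideal containing `s`, so `[g, χ_s] = [h, χ_s]`. Thus `ρ_{χ_e}`
cannot tell the two indicators apart. If it is injective, the two elements coincide, and so do their
components at `χ`. Applying these to the basis vector at the unit recovers the indicators on the
source fiber of `χ`, so `[g, χ] ∈ D(h, U)`; a bisection has only one arrow over `χ`, so `[g, χ] =
[h, χ]`.

For the second claim, strong regularity is applied directly to the single element `g⁻¹h`, which
fixes `A ∩ dom g` pointwise. It gives constructible ideals covering this set on each of which `g`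
and `h` agree. Since `χ` is a limit of points `χ_s`, it takes the value `1` at one of these ideals,
and this is exactly equality of germs. -/

/-- Injectivity of `p` where it is defined makes the nonzero terms a reindexed partial sum of the
series for the norm of `ξ`. This bound gives both well-definedness and contractivity of
`ellTwoPartial`. -/
theorem sum_norm_rpow_elim_le {ι : Type u} (p : ι → Option ι)
    (hp : ∀ i j k, p i = some k → p j = some k → i = j) (ξ : EllTwo ι) (s : Finset ι) :
    ∑ i ∈ s, ‖(p i).elim (0 : ℂ) ξ‖ ^ (2 : ℝ≥0∞).toReal ≤ ‖ξ‖ ^ (2 : ℝ≥0∞).toReal := by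
  classical
  have hinj : Set.InjOn p (s.filter fun i => (p i).isSome) := by
    intro i hi j _ h
    obtain ⟨k, hk⟩ := Option.isSome_iff_exists.1 (Finset.mem_filter.1 hi).2
    exact hp i j k hk (h ▸ hk)
  calc ∑ i ∈ s, ‖(p i).elim (0 : ℂ) ξ‖ ^ (2 : ℝ≥0∞).toReal
      = ∑ i ∈ s.filter fun i => (p i).isSome, ‖(p i).elim (0 : ℂ) ξ‖ ^ (2 : ℝ≥0∞).toReal := by
        refine (Finset.sum_filter_of_ne fun i _ h => ?_).symm
        by_contra hn
        rw [Option.not_isSome_iff_eq_none] at hn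
        simp [hn] at h
    _ = ∑ o ∈ (s.filter fun i => (p i).isSome).image p,
          ‖o.elim (0 : ℂ) ξ‖ ^ (2 : ℝ≥0∞).toReal :=
        (Finset.sum_image (f := fun o : Option ι => ‖o.elim (0 : ℂ) ξ‖ ^ (2 : ℝ≥0∞).toReal)
          hinj).symm
    _ = ∑ k ∈ ((s.filter fun i => (p i).isSome).image p).eraseNone,
          ‖ξ k‖ ^ (2 : ℝ≥0∞).toReal := by
        symm
        refine Finset.sum_bij (fun k _ => some k) (fun k hk => Finset.mem_eraseNone.1 hk)
          (fun _ _ _ _ h => Option.some.inj h) (fun o ho => ?_) (fun _ _ => rfl)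
        obtain ⟨i, hi, rfl⟩ := Finset.mem_image.1 ho
        obtain ⟨k, hk⟩ := Option.isSome_iff_exists.1 (Finset.mem_filter.1 hi).2
        exact ⟨k, Finset.mem_eraseNone.2 (hk ▸ ho), hk.symm⟩
    _ ≤ ‖ξ‖ ^ (2 : ℝ≥0∞).toReal := lp.sum_rpow_le_norm_rpow (by norm_num) ξ _

/-- The partial isometry of `ℓ²(ι)` induced by an injective partially defined map of `ι`. -/
noncomputable def ellTwoPartial {ι : Type u} (p : ι → Option ι)
    (hp : ∀ i j k, p i = some k → p j = some k → i = j) : EllTwo ι →L[ℂ] EllTwo ι :=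
  LinearMap.mkContinuous
    { toFun := fun ξ => ⟨fun i => (p i).elim (0 : ℂ) ξ,
        memℓp_gen' (sum_norm_rpow_elim_le p hp ξ)⟩
      map_add' := fun ξ η => by
        ext i
        change (p i).elim (0 : ℂ) (ξ + η : EllTwo ι) = (p i).elim (0 : ℂ) ξ + (p i).elim (0 : ℂ) η
        cases p i
        exacts [(add_zero (0 : ℂ)).symm, rfl]
      map_smul' := fun c ξ => by
        ext i
        change (p i).elim (0 : ℂ) (c • ξ : EllTwo ι) = c • (p i).elim (0 : ℂ) ξ
        cases p i <;> simp }
    1 fun ξ => by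
      rw [one_mul]
      exact lp.norm_le_of_forall_sum_le (by norm_num) (norm_nonneg _)
        (sum_norm_rpow_elim_le p hp ξ)

theorem ellTwoPartial_apply {ι : Type u} (p : ι → Option ι)
    (hp : ∀ i j k, p i = some k → p j = some k → i = j) (ξ : EllTwo ι) (i : ι) :
    ellTwoPartial p hp ξ i = (p i).elim (0 : ℂ) ξ := rfl

theorem norm_ellTwoPartial_le {ι : Type u} (p : ι → Option ι)
    (hp : ∀ i j k, p i = some k → p j = some k → i = j) : ‖ellTwoPartial p hp‖ ≤ 1 :=
  LinearMap.mkContinuous_norm_le _ zero_le_one _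

/-! ### Cancellation in groupoids. -/

namespace Grpd

variable {X : Type u} {G : Type v} [Grpd X G]

theorem mul_congr_left {a a' b : G} (e : a = a') (h : src a = rng b) :
    mul a b h = mul a' b (e ▸ h) := by subst e; rfl

theorem mul_congr_right {a b b' : G} (e : b = b') (h : src a = rng b) :
    mul a b h = mul a b' (e ▸ h) := by subst e; rfl

theorem mul_inv_mul (a b : G) (h : rng a = rng b) :
    mul a (mul (inv a) b ((src_inv a).trans h)) (by rw [rng_mul, rng_inv]) = b := by
  rw [← mul_assoc a (inv a) b (rng_inv a).symm ((src_inv a).trans h),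
    mul_congr_left (mul_inv a)]
  -- The unit sits at `rng a`, while `unit_mul` needs it at `rng b`; generalizing the object allows
  -- substitution in the dependent product.
  have : ∀ (x : X) (e : x = rng b),
      mul (unit x) b ((src_unit x).trans e) = b := by
    rintro _ rfl
    exact unit_mul b
  exact this _ h

end Grpd

/-! ### Indicators of bisections in the reduced C*-algebra. -/

section bisection

variable {X : Type u} {G : Type v} [Grpd X G] {B : Set G}

theorem SrcFiber.mul_invMul {x : X} (a : SrcFiber G x) (k : G) (h : Grpd.rng k = Grpd.rng a.1) :
    Grpd.mul k (a.invMul k h).1 (by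
      change _ = Grpd.rng (Grpd.mul _ _ _)
      rw [Grpd.rng_mul, Grpd.rng_inv]) = a.1 := Grpd.mul_inv_mul k a.1 h

theorem SrcFiber.rng_invMul {x : X} (a : SrcFiber G x) (k : G)
    (h : Grpd.rng k = Grpd.rng a.1) : Grpd.rng (a.invMul k h).1 = Grpd.src k :=
  (Grpd.rng_mul _ _ _).trans (Grpd.rng_inv _)

open Classical in
/-- The partial action `a ↦ k⁻¹ a`, `k ∈ B`, `r(k) = r(a)`, of a set `B` of arrows on a fiber of
the source map. -/
noncomputable def bisectionAct (B : Set G) (x : X) (a : SrcFiber G x) : Option (SrcFiber G x) :=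
  if h : ∃ k ∈ B, Grpd.rng k = Grpd.rng a.1 then
    some (a.invMul h.choose h.choose_spec.2) else none

/-- If `c = k⁻¹a` with `k ∈ B`, then `r(c) = s(k)`, so `c` determines `k` by injectivity of the
source on `B`, and then `a = kc`. -/
theorem bisectionAct_injective (hs : Set.InjOn (Grpd.src : G → X) B) (x : X)
    (a b c : SrcFiber G x) (ha : bisectionAct B x a = some c) (hb : bisectionAct B x b = some c) :
    a = b := by
  unfold bisectionAct at ha hb
  split_ifs at ha hb with h1 h2
  rw [Option.some.injEq] at ha hb
  -- Stated for arbitrary arrows in place of the chosen ones, so that they can be identified by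
  -- substitution.
  have key : ∀ k k' (_ : k ∈ B) (_ : k' ∈ B) (e : Grpd.rng k = Grpd.rng a.1)
      (e' : Grpd.rng k' = Grpd.rng b.1), a.invMul k e = c → b.invMul k' e' = c → a = b := by
    intro k k' hk hk' e e' h h'
    obtain rfl : k = k' := hs hk hk' (by
      rw [← a.rng_invMul k e, ← b.rng_invMul k' e', h, h'])
    apply Subtype.ext
    rw [← a.mul_invMul k e, ← b.mul_invMul k e']
    exact Grpd.mul_congr_right (congrArg Subtype.val (h.trans h'.symm)) _
  exact key _ _ h1.choose_spec.1 h2.choose_spec.1 _ _ ha hb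

/-- The partial isometry `ρ_x(1_B)` of a bisection `B`. -/
noncomputable def bisectionOp (hs : Set.InjOn (Grpd.src : G → X) B) (x : X) :
    EllTwo (SrcFiber G x) →L[ℂ] EllTwo (SrcFiber G x) :=
  ellTwoPartial (bisectionAct B x) (bisectionAct_injective hs x)

open Classical in
-- Injectivity of the range on `B` leaves at most one nonzero term in the convolution sum, the one
-- of the chosen arrow.
theorem isRho_bisectionOp (hs : Set.InjOn (Grpd.src : G → X) B)
    (hr : Set.InjOn (Grpd.rng : G → X) B) (x : X) :
    IsRho x (B.indicator 1) (bisectionOp hs x) := by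
  intro ξ a
  rw [bisectionOp, ellTwoPartial_apply, bisectionAct]
  split_ifs with h
  · rw [tsum_eq_single ⟨h.choose, h.choose_spec.2⟩, Set.indicator_of_mem h.choose_spec.1]
    · simp
    · rintro ⟨k, hk⟩ hne
      rw [Set.indicator_of_notMem, zero_mul]
      exact fun hB => hne (Subtype.ext (hr hB h.choose_spec.1 (hk.trans h.choose_spec.2.symm)))
  · symm
    refine (tsum_congr fun k => ?_).trans tsum_zero
    rw [Set.indicator_of_notMem, zero_mul]
    exact fun hB => h ⟨k.1, hB, k.2⟩

/-- The family `(ρ_x(1_B))_x` of a bisection `B`. -/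
noncomputable def bisectionFamily (hs : Set.InjOn (Grpd.src : G → X) B) : FiberOps G :=
  ⟨fun x => bisectionOp hs x, memℓp_infty ⟨1, by
    rintro _ ⟨x, rfl⟩
    exact norm_ellTwoPartial_le _ _⟩⟩

theorem bisectionFamily_mem_reducedCStar [TopologicalSpace G]
    (hs : Set.InjOn (Grpd.src : G → X) B) (hr : Set.InjOn (Grpd.rng : G → X) B)
    (hB : B.indicator 1 ∈ CcSpan G) : bisectionFamily hs ∈ reducedCStar G :=
  NonUnitalStarSubalgebra.le_topologicalClosure _
    (NonUnitalStarAlgebra.subset_adjoin ℂ _ ⟨_, hB, isRho_bisectionOp hs hr⟩)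

theorem indicator_mem_ccSpan [TopologicalSpace G] (ho : IsOpen B) (ht : T2Space B)
    (hc : IsCompact B) : (B.indicator 1 : G → ℂ) ∈ CcSpan G := by
  refine Submodule.subset_span ⟨B, ho, ht, ?_, B, subset_rfl, hc, fun g hg => ?_⟩
  · exact continuousOn_const.congr fun g hg => Set.indicator_of_mem hg _
  · exact Set.indicator_of_notMem hg _

/-- A term `f(k) ξ(k⁻¹a)` involves the arrow `k⁻¹a` of the fiber, whose range is `s(k)`. Hence the
operator at `x` depends only on `f` at arrows with source in the orbit of `x`. -/
theorem isRho_unique {x : X} {f f' : G → ℂ}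
    {T T' : EllTwo (SrcFiber G x) →L[ℂ] EllTwo (SrcFiber G x)} (h : IsRho x f T)
    (h' : IsRho x f' T')
    (hf : ∀ k (a : SrcFiber G x), Grpd.rng a.1 = Grpd.src k → f k = f' k) : T = T' := by
  ext ξ a
  rw [h, h']
  exact tsum_congr fun k => by rw [hf k.1 _ (a.rng_invMul k.1 k.2)]

open Classical in
-- Since `k⁻¹a` is the unit at `x` only for `k = a`, a single term survives. The operator at `x`
-- therefore remembers `f` on the whole source fiber.
theorem isRho_single_unit {x : X} {f : G → ℂ}
    {T : EllTwo (SrcFiber G x) →L[ℂ] EllTwo (SrcFiber G x)} (h : IsRho x f T)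
    (a : SrcFiber G x) : T (lp.single 2 ⟨Grpd.unit x, Grpd.src_unit x⟩ 1) a = f a.1 := by
  rw [h, tsum_eq_single ⟨a.1, rfl⟩]
  · have : a.invMul a.1 rfl = ⟨Grpd.unit x, Grpd.src_unit x⟩ := by
      obtain ⟨a, rfl⟩ := a
      exact Subtype.ext (Grpd.inv_mul a)
    rw [this]
    simp
  · rintro ⟨k, hk⟩ hne
    rw [lp.single_apply_ne, mul_zero]
    intro e
    apply hne
    apply Subtype.ext
    have h1 := a.mul_invMul k hk
    have h2 : (a.invMul k hk).1 = Grpd.unit x := congrArg Subtype.val e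
    have h3 : Grpd.src k = x := by rw [← a.rng_invMul k hk, h2, Grpd.rng_unit]
    rw [Grpd.mul_congr_right h2] at h1
    subst h3
    exact (Grpd.mul_unit k).symm.trans h1

end bisection

/-! ### Topology of the semi-characters and of the groupoid of germs. -/

section paterson

variable {S : Type u} [LeftCancelMonoid S]

/-- The ideal `sS` lies in every constructible ideal containing `s`, so it is where germs at `χ_s`
are to be compared. -/
theorem IsConstructible.principal (s : S) : IsConstructible S (Set.range fun r => s * r) := by
  have h := IsConstructible.step 1 s Set.univ .univ
  simpa using h

namespace SemiChar

theorem isOpen_eq (X : ConstrIdeal S) (b : Bool) : IsOpen {χ : SemiChar S | χ.1 X = b} :=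
  (isOpen_discrete ({b} : Set Bool)).preimage (f := fun χ : SemiChar S => χ.1 X)
    ((continuous_apply X).comp continuous_subtype_val)

theorem isClosed_eq (X : ConstrIdeal S) (b : Bool) : IsClosed {χ : SemiChar S | χ.1 X = b} :=
  (isClosed_discrete ({b} : Set Bool)).preimage (f := fun χ : SemiChar S => χ.1 X)
    ((continuous_apply X).comp continuous_subtype_val)

/-- By monotonicity, a multiplicative map is nonzero exactly when it is `1` at `S`. This makes being
nonzero a closed condition, so the semi-characters are closed in a product of finite spaces. -/
instance : CompactSpace (SemiChar S) := by
  have : {χ : ConstrIdeal S → Bool | (∀ X Y, χ (X.inter Y) = (χ X && χ Y)) ∧ ∃ X, χ X = true} =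
      {χ | ∀ X Y, χ (X.inter Y) = (χ X && χ Y)} ∩ {χ | χ ConstrIdeal.univ = true} := by
    ext χ
    refine and_congr_right fun h => ⟨fun h' => univ_eq ⟨χ, h, h'⟩, fun h' => ⟨_, h'⟩⟩
  refine (isCompact_iff_compactSpace (s := {χ : ConstrIdeal S → Bool |
    (∀ X Y, χ (X.inter Y) = (χ X && χ Y)) ∧ ∃ X, χ X = true})).1 (IsClosed.isCompact ?_)
  rw [this]
  simp only [Set.ofPred_forall]
  refine (isClosed_iInter fun X => isClosed_iInter fun Y => ?_).inter
    (_root_.isClosed_eq (continuous_apply ConstrIdeal.univ) continuous_const)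
  have h : Continuous fun p : Bool × Bool => p.1 && p.2 := continuous_of_discreteTopology
  have h' : Continuous fun χ : ConstrIdeal S → Bool => (χ X, χ Y) :=
    (continuous_apply X).prodMk (continuous_apply Y)
  exact _root_.isClosed_eq (continuous_apply _) (h.comp h')

end SemiChar

namespace Paterson

theorem continuous_src : Continuous (Grpd.src : Paterson S → SemiChar S) := by
  refine ⟨fun V hV => ?_⟩
  have : (Grpd.src : Paterson S → SemiChar S) ⁻¹' V =
      ⋃ g : InvHull S, basicSet g (V ∩ {χ | χ.1 g.dom = true}) := by
    ext a
    obtain ⟨g, χ, h, rfl⟩ := a.exists_rep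
    simp only [Set.mem_preimage, Set.mem_iUnion]
    constructor
    · exact fun hV => ⟨g, χ, h, ⟨hV, h⟩, rfl⟩
    · rintro ⟨g', χ', h', ⟨hV, _⟩, e⟩
      rw [e]
      exact hV
  rw [this]
  exact isOpen_iUnion fun g => TopologicalSpace.isOpen_generateFrom_of_mem
    ⟨g, _, hV.inter (SemiChar.isOpen_eq _ _), Set.inter_subset_right, rfl⟩

/-- An ideal `X` witnessing `[g, χ] = [h, χ]` also witnesses `[g, ψ] = [h, ψ]` for all `ψ` near `χ`,
as `ψ(p_X) = 1` is an open condition. -/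
theorem continuous_mk (g : InvHull S) :
    Continuous fun χ : {χ : SemiChar S // χ.1 g.dom = true} => mk g χ.1 χ.2 := by
  refine continuous_generateFrom_iff.2 ?_
  rintro _ ⟨h, V, hV, hVh, rfl⟩
  refine isOpen_iff_mem_nhds.2 ?_
  rintro ⟨χ, hχ⟩ ⟨χ', hχ', hχV, e⟩
  obtain rfl : χ = χ' := congrArg src e
  obtain ⟨_, ⟨X, rfl, hX⟩, e⟩ := (mk_eq_iff _ _ _ _ _).1 e
  refine Filter.mem_of_superset (((hV.inter (SemiChar.isOpen_eq X true)).preimage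
    continuous_subtype_val).mem_nhds ⟨hχV, hX⟩) ?_
  rintro ⟨ψ, hψ⟩ ⟨hψV, hψX⟩
  exact ⟨ψ, hVh hψV, hψV, (mk_eq_iff _ _ _ _ _).2 ⟨_, ⟨X, rfl, hψX⟩, e⟩⟩

end Paterson

/-! ### Compact open bisections over `Ω(S)` and injectivity of the quotient map. -/

namespace GroupoidP

/-- `{[g, χ] | χ ∈ U ∩ Ω(S)}`. -/
def basicSet (g : InvHull S) (U : Set (SemiChar S)) : Set (GroupoidP S) :=
  {a | a.1 ∈ Paterson.basicSet g U}

variable {g : InvHull S} {U : Set (SemiChar S)}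

theorem src_injOn_basicSet :
    Set.InjOn (Grpd.src : GroupoidP S → omegaSet S) (basicSet g U) := by
  rintro ⟨_, _⟩ ⟨χ, h, _, rfl⟩ ⟨_, _⟩ ⟨χ', h', _, rfl⟩ e
  obtain rfl : χ = χ' := congrArg Subtype.val e
  rfl

theorem rng_injOn_basicSet :
    Set.InjOn (Grpd.rng : GroupoidP S → omegaSet S) (basicSet g U) := by
  rintro ⟨_, _⟩ ⟨χ, h, _, rfl⟩ ⟨_, _⟩ ⟨χ', h', _, rfl⟩ e
  have e : SemiChar.act g χ h = SemiChar.act g χ' h' := congrArg Subtype.val e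
  obtain rfl : χ = χ' := by
    refine Subtype.ext (funext fun X => ?_)
    -- The range determines the source: `χ` is recovered from `χ(g⁻¹ · g)` by translating back with
    -- `g⁻¹`.
    rw [← χ.pre_inv_eq g h, ← χ'.pre_inv_eq g h']
    exact congrArg (fun η : SemiChar S => η.1 (g.inv.pre X)) e
  rfl

/-- The source map embeds the set injectively and continuously into a Hausdorff space, and `χ ↦ [g,
χ]` exhibits it as a continuous image of the compact set `U ∩ Ω(S)`. -/
theorem indicator_basicSet_mem_ccSpan (hU : IsClopen U) (hUg : U ⊆ {χ | χ.1 g.dom = true}) :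
    ((basicSet g U).indicator 1 : GroupoidP S → ℂ) ∈ CcSpan (GroupoidP S) := by
  refine indicator_mem_ccSpan ?_ ?_ ?_
  · exact IsOpen.preimage (t := Paterson.basicSet g U) continuous_subtype_val
      (TopologicalSpace.isOpen_generateFrom_of_mem ⟨g, U, hU.2, hUg, rfl⟩)
  · refine T2Space.of_injective_continuous
      (f := fun a : basicSet g U => Grpd.src a.1.1) ?_ ?_
    · exact fun a b e => Subtype.ext (src_injOn_basicSet a.2 b.2 (Subtype.ext e))
    · exact Paterson.continuous_src.comp
        (continuous_subtype_val.comp continuous_subtype_val)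
  · have hc : IsCompact (U ∩ omegaSet S) := (hU.1.inter isClosed_closure).isCompact
    have := isCompact_iff_compactSpace.1 hc
    let f : ↥(U ∩ omegaSet S) → GroupoidP S := fun χ => mk g χ.1 χ.2.2 (hUg χ.2.1)
    have hf : Continuous f := Continuous.subtype_mk ((Paterson.continuous_mk g).comp
      (Continuous.subtype_mk continuous_subtype_val fun χ => hUg χ.2.1)) _
    convert isCompact_range hf
    ext a
    constructor
    · rintro ⟨χ, h, hχ, e⟩
      have ha : χ ∈ omegaSet S := by
        have := a.2
        rw [e] at this
        exact this
      exact ⟨⟨χ, hχ, ha⟩, Subtype.ext e.symm⟩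
    · rintro ⟨χ, rfl⟩
      exact ⟨χ.1, hUg χ.2.1, χ.2.1, rfl⟩

theorem src_eq_point (a : GroupoidP S) (b : SrcFiber (GroupoidP S) (chiE S))
    (h : Grpd.rng b.1 = Grpd.src a) : ∃ s, a.1.src = SemiChar.point s := by
  have : a.1.src ∈ Set.range (SemiChar.point (S := S)) := by
    rw [← orbit_point_one]
    exact ⟨b.1.1, congrArg Subtype.val b.2, congrArg Subtype.val h⟩
  obtain ⟨s, hs⟩ := this
  exact ⟨s, hs.symm⟩

theorem mk_eq_mk_of_rel_of_rho (H : RhoDefinesIso S) {g h : InvHull S} {χ : SemiChar S}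
    (hχ : χ ∈ omegaSet S) (hg : χ.1 g.dom = true) (hh : χ.1 h.dom = true)
    (e : SemiChar.GermEq SemiChar.HoldsExt χ g h) : mk g χ hχ hg = mk h χ hχ hh := by
  classical
  obtain ⟨φ, hφ⟩ := H
  obtain ⟨_, ⟨X, F, rfl, hX, hF⟩, e⟩ := e
  -- Both domains are included so that `[g, ψ]` and `[h, ψ]` exist for every `ψ ∈ U`; the other
  -- conditions put `s` in the set of agreement whenever `χ_s ∈ U`.
  let U : Set (SemiChar S) := {ψ | ψ.1 g.dom = true} ∩ {ψ | ψ.1 h.dom = true} ∩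
    {ψ | ψ.1 X = true} ∩ ⋂ Y ∈ F, {ψ | ψ.1 Y = false}
  have hU : IsClopen U := by
    have hc : ∀ (Y : ConstrIdeal S) b, IsClopen {ψ : SemiChar S | ψ.1 Y = b} :=
      fun Y b => ⟨SemiChar.isClosed_eq Y b, SemiChar.isOpen_eq Y b⟩
    exact (((hc _ _).inter (hc _ _)).inter (hc _ _)).inter
      (isClopen_biInter_finset fun Y _ => hc Y false)
  have hχU : χ ∈ U := ⟨⟨⟨hg, hh⟩, hX⟩, Set.mem_iInter₂.2 hF⟩
  let A (k : InvHull S) (hk : U ⊆ {χ | χ.1 k.dom = true}) : reducedCStar (GroupoidP S) :=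
    ⟨bisectionFamily (src_injOn_basicSet (g := k) (U := U)),
      bisectionFamily_mem_reducedCStar _ rng_injOn_basicSet (indicator_basicSet_mem_ccSpan hU hk)⟩
  have hρ : ∀ (k : InvHull S) x, IsRho x ((basicSet k U).indicator 1)
      (bisectionOp (src_injOn_basicSet (g := k) (U := U)) x) :=
    fun k x => isRho_bisectionOp _ rng_injOn_basicSet x
  have hgU : U ⊆ {χ | χ.1 g.dom = true} := fun ψ h => h.1.1.1
  have hhU : U ⊆ {χ | χ.1 h.dom = true} := fun ψ h => h.1.1.2
  have hpt : ∀ s, SemiChar.point s ∈ U → ∀ p q,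
      Paterson.mk g (SemiChar.point s) p = Paterson.mk h (SemiChar.point s) q := by
    rintro s ⟨⟨_, hsX⟩, hsF⟩ p q
    refine (Paterson.mk_eq_iff _ _ _ _ _).2 ⟨_, ⟨⟨_, IsConstructible.principal s⟩, rfl,
      (SemiChar.point_eq_true _ _).2 ⟨1, mul_one s⟩⟩, ?_⟩
    rintro _ ⟨r, rfl⟩
    obtain ⟨t, ht⟩ := Option.isSome_iff_exists.1 ((SemiChar.point_eq_true _ _).1 p)
    have hs : g.1 s = h.1 s := e ⟨(SemiChar.point_eq_true _ _).1 hsX, fun hm => by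
      obtain ⟨Y, hY, hsY⟩ := Set.mem_iUnion₂.1 hm
      have := (SemiChar.point_eq_true _ _).2 hsY
      rw [Set.mem_iInter₂.1 hsF Y hY] at this
      exact Bool.noConfusion this⟩
    exact (g.2.map_mul s r t ht).trans (h.2.map_mul s r t (hs ▸ ht)).symm
  -- The two bisections have the same arrows over each `χ_s`, and the fiber at `χ_e` detects no
  -- others.
  have hE : bisectionOp (src_injOn_basicSet (g := g) (U := U)) (chiE S) =
      bisectionOp (src_injOn_basicSet (g := h) (U := U)) (chiE S) := by
    refine isRho_unique (hρ g _) (hρ h _) fun a b hab => ?_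
    obtain ⟨s, hs⟩ := src_eq_point a b hab
    have : a ∈ basicSet g U ↔ a ∈ basicSet h U := by
      constructor
      · rintro ⟨ψ, p, hψ, e⟩
        obtain rfl : ψ = SemiChar.point s := by rw [← hs, e, Paterson.src_mk]
        exact ⟨_, hhU hψ, hψ, e.trans (hpt s hψ _ _)⟩
      · rintro ⟨ψ, p, hψ, e⟩
        obtain rfl : ψ = SemiChar.point s := by rw [← hs, e, Paterson.src_mk]
        exact ⟨_, hgU hψ, hψ, e.trans (hpt s hψ _ _).symm⟩
    simp only [Set.indicator, this]
  have hA : A g hgU = A h hhU := by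
    -- The only use of the isomorphism is its injectivity.
    apply EquivLike.injective φ
    apply Subtype.ext
    rw [hφ, hφ]
    exact congrArg (ellTwoCongr (fiberEquiv S)).conjStarAlgEquiv hE
  have hT : bisectionOp (src_injOn_basicSet (g := g) (U := U)) (⟨χ, hχ⟩ : omegaSet S) =
      bisectionOp (src_injOn_basicSet (g := h) (U := U)) ⟨χ, hχ⟩ :=
    congrArg (fun a : reducedCStar (GroupoidP S) => a.1.1 ⟨χ, hχ⟩) hA
  have h1 := isRho_single_unit (hρ g ⟨χ, hχ⟩) ⟨mk g χ hχ hg, rfl⟩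
  -- Comparing the coefficient at `[g, χ]`: the indicator of the bisection of `h` takes the value
  -- `1` there.
  rw [hT, isRho_single_unit (hρ h ⟨χ, hχ⟩), Set.indicator_of_mem (a := mk g χ hχ hg)
    (show mk g χ hχ hg ∈ basicSet g U from ⟨χ, hg, hχU, rfl⟩)] at h1
  have h2 : mk g χ hχ hg ∈ basicSet h U :=
    Set.mem_of_indicator_ne_zero (f := 1) (h1.trans_ne one_ne_zero)
  exact src_injOn_basicSet (g := h) (U := U) h2 ⟨χ, hh, hχU, rfl⟩ rfl

theorem mk_eq_mk_of_rel_of_regular (H : StronglyCStarRegular S) {g h : InvHull S} {χ : SemiChar S}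
    (hχ : χ ∈ omegaSet S) (hg : χ.1 g.dom = true) (hh : χ.1 h.dom = true)
    (e : SemiChar.GermEq SemiChar.HoldsExt χ g h) : mk g χ hχ hg = mk h χ hχ hh := by
  classical
  obtain ⟨_, ⟨X, F, rfl, hX, hF⟩, e⟩ := e
  let Xs : Fin F.card → ConstrIdeal S := fun i => (F.equivFin.symm i).1
  have hXs : ∀ i, χ.1 (Xs i) = false := fun i => hF _ (F.equivFin.symm i).2
  have hU : ⋃ i, (Xs i).1 = ⋃ Y ∈ F, Y.1 := by
    ext s
    simp only [Set.mem_iUnion, exists_prop]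
    constructor
    · rintro ⟨i, hi⟩; exact ⟨_, (F.equivFin.symm i).2, hi⟩
    · rintro ⟨Y, hY, hs⟩
      refine ⟨F.equivFin ⟨Y, hY⟩, ?_⟩
      simpa [Xs] using hs
  rw [← hU] at e
  -- Intersecting with `dom g` ensures that `gs = hs` is defined, so that `g⁻¹h` really fixes `s`.
  let D := X.inter g.dom
  have hD : χ.1 D = true := (χ.inter_eq_true _ _).2 ⟨hX, hg⟩
  have hmem : ∀ s (E : Finset (ConstrIdeal S)), D ∈ E → F ⊆ E →
      (∀ Y ∈ E, (χ.1 Y = true ↔ s ∈ Y.1)) → s ∈ D.1 \ ⋃ i, (Xs i).1 := by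
    intro s E hDE hFE hs
    refine ⟨(hs D hDE).1 hD, fun hm => ?_⟩
    obtain ⟨i, hi⟩ := Set.mem_iUnion.1 hm
    have := (hs _ (hFE (F.equivFin.symm i).2)).2 hi
    exact Bool.noConfusion ((hXs i).symm.trans this)
  obtain ⟨s, hs⟩ := (mem_omegaSet_iff χ).1 hχ (insert D F)
  obtain ⟨l, Y, k, hcov, hfix⟩ := H 1 F.card (fun _ => g.inv.mul h) D Xs
    ⟨s, hmem s _ (by simp) (by simp) hs⟩ fun s hs => by
      refine Set.mem_iUnion.2 ⟨0, ?_⟩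
      obtain ⟨t, ht⟩ := Option.isSome_iff_exists.1 hs.1.2
      change (h.1 s).bind g.1.symm = some s
      rw [← e ⟨hs.1.1, hs.2⟩, ht]
      exact (PEquiv.eq_some_iff g.1).2 ht
  -- A new approximating point is needed, agreeing with `χ` also at the covering ideals: it lies in
  -- some `Y j`, which transfers to `χ(p_{Y j}) = 1`.
  obtain ⟨s, hs⟩ := (mem_omegaSet_iff χ).1 hχ (insert D F ∪ Finset.univ.image Y)
  obtain ⟨j, hj⟩ := Set.mem_iUnion.1
    (hcov (hmem s _ (by simp) (fun Z hZ => by simp [hZ]) hs))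
  have hYj : χ.1 (Y j) = true := (hs _ (by simp)).2 hj
  refine Subtype.ext ((Paterson.mk_eq_iff _ _ _ _ _).2 ⟨_, ⟨Y j, rfl, hYj⟩, fun s hs => ?_⟩)
  have := hfix j s hs
  change (h.1 s).bind g.1.symm = some s at this
  obtain ⟨t, ht, ht'⟩ := Option.bind_eq_some_iff.1 this
  rw [ht]
  exact (PEquiv.eq_some_iff g.1).1 ht'

/-- An injective topological quotient map is a homeomorphism, and the operations of the quotient are
induced from `𝒢_P(S)`. -/
theorem isTopIso_toQ (H : ∀ (g h : InvHull S) (χ : SemiChar S) (hχ : χ ∈ omegaSet S)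
    (hg : χ.1 g.dom = true) (hh : χ.1 h.dom = true),
    SemiChar.GermEq SemiChar.HoldsExt χ g h → mk g χ hχ hg = mk h χ hχ hh) :
    Grpd.IsTopIso (toQ : GroupoidP S → GroupoidQ S) where
  isHomeomorph := by
    have hq : Topology.IsQuotientMap (toQ : GroupoidP S → GroupoidQ S) := isQuotientMap_quot_mk
    refine isHomeomorph_iff_isQuotientMap_injective.2 ⟨hq, fun a b hab => ?_⟩
    obtain ⟨χ, hχ, g, h, hg, hh, rfl, rfl, e⟩ := (GroupoidQ.toQ_eq_iff a b).1 hab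
    exact H g h χ hχ hg hh e
  src_map _ := rfl
  rng_map _ := rfl
  unit_map _ := rfl
  inv_map a := (GroupoidQ.inv_toQ a).symm
  mul_map a b h := (GroupoidQ.mul_toQ a b h).symm

end GroupoidP

end paterson

theorem proposition2p11 (S : Type u) [LeftCancelMonoid S] :
    (RhoDefinesIso S → Grpd.IsTopIso (GroupoidP.toQ : GroupoidP S → GroupoidQ S)) ∧
      (StronglyCStarRegular S →
        Grpd.IsTopIso (GroupoidP.toQ : GroupoidP S → GroupoidQ S)) :=
  ⟨fun H => GroupoidP.isTopIso_toQ fun _ _ _ hχ hg hh e =>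
      GroupoidP.mk_eq_mk_of_rel_of_rho H hχ hg hh e,
    fun H => GroupoidP.isTopIso_toQ fun _ _ _ hχ hg hh e =>
      GroupoidP.mk_eq_mk_of_rel_of_regular H hχ hg hh e⟩
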